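/- Let $H$ be a finite-dimensional complex Hilbert space and let $\mathcal S$ be the manifold of strictly positive density operators on $H$, an open subset of the affine space of Hermitian operators of trace $1$. Tangent vectors of $\mathcal S$ are thereby identified with Hermitian operators of trace $0$. For $\rho\in\mathcal S$ let $\langle A,B\rangle_\rho=\mathrm{Re}\,\mathrm{Tr}(\rho AB)$ on Hermitian operators. For a tangent vector $X$ at $\rho$ let the SLD $L_X$ be the Hermitian solution of $X=\frac12(\rho L_X+L_X\rho)$, and let $g_\rho(X,Y)=\langle L_X,L_Y\rangle_\rho$ be the SLD metric. The m-connection $\nabla^{(m)}$ on $\mathcal S$ is the flat connection of the affine structure, and the e-connection $\nabla^{(e)}$ is its dual, given by $Xg(Y,Z)=g(\nabla^{(e)}_XY,Z)+g(Y,\nabla^{(m)}_XZ)$. A model $(M,\xi)$ is a connected $n$-dimensional submanifold $M$ of $\mathcal S$ with a global coordinate system $\xi=(\xi^1,\dots,\xi^n)$; that is, $M=\{\rho_\xi : \xi\in\Xi\}$, where $\Xi\subset\mathbb R^n$ is open and connected and $\xi\mapsto\rho_\xi$ is a smooth injective immersion. Put $\partial_i=\partial/\partial\xi^i$ and $G_\rho=[g_\rho(\partial_i,\partial_j)]$.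 $M$ is e-autoparallel in $\mathcal S$ if $\nabla^{(e)}_XY$ is tangent to $M$ for all vector fields $X,Y$ on $M$. The coordinate system $\xi$ is m-affine if all $\partial_i$ are parallel for the m-connection $\nabla^{(m)}_M$ of $M$, the dual on $(M,g|_M)$ of the connection induced by $\nabla^{(e)}$: $Xg(Y,Z)=g(\nabla^{(e)}_XY,Z)+g(Y,(\nabla^{(m)}_M)_XZ)$ for vector fields $X,Y,Z$ on $M$. An estimator is a POVM $\Pi(d\hat\xi)$ on $\mathbb R^n$ (acting on $H$) with finite second moments. Put $E_\rho(\Pi)=\int\hat\xi\,\mathrm{Tr}(\rho\,\Pi(d\hat\xi))$ and $V_\rho(\Pi)=\int(\hat\xi-\xi(\rho))(\hat\xi-\xi(\rho))^T\,\mathrm{Tr}(\rho\,\Pi(d\hat\xi))$. $\Pi$ is locally unbiased at $\rho\in M$ if $E^i_\rho(\Pi)=\xi^i(\rho)$ and $\partial_jE^i_\rho(\Pi)=\delta^i_j$ for all $i,j$. A family $(\Pi_\varepsilon)_{0<\varepsilon<\varepsilon_1}$ of estimators, $0<\varepsilon_1\le\infty$, is called a $W$-efficient filtration for $\xi$, where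 $W$ is a positive semidefinite real $n\times n$ matrix, if at every $\rho\in M$ each $\Pi_\varepsilon$ is locally unbiased and $\lim_{\varepsilon\downarrow0}\mathrm{tr}(WV_\rho(\Pi_\varepsilon))$ exists and is at most $\mathrm{tr}(WV_\rho(\Pi'))$ for every estimator $\Pi'$ that is locally unbiased at $\rho$. **Theorem.** For a model $(M,\xi)$ the following conditions are equivalent. (i) $M$ is e-autoparallel in $\mathcal S$, and $\xi$ is an m-affine coordinate system. (ii) For every $u\in\mathbb R^n$ there exists a $uu^T$-efficient filtration for $\xi$. Moreover, for every $u\in\mathbb R^n$, a family $(\Pi_\varepsilon)_{0<\varepsilon<\varepsilon_1}$ of estimators is a $uu^T$-efficient filtration for $\xi$ if and only if, at every $\rho\in M$, each $\Pi_\varepsilon$ is locally unbiased and $u^TV_\rho(\Pi_\varepsilon)u\to u^TG_\rho^{-1}u$ as $\varepsilon\downarrow0$. -/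

import Mathlib

open Set Filter Topology MeasureTheory
open scoped ContDiff

set_option linter.unusedSectionVars false

namespace QInfoGeom

noncomputable section

variable {H : Type*} [NormedAddCommGroup H] [InnerProductSpace ℂ H] [FiniteDimensional ℂ H]
  [CompleteSpace H]

/-- The trace of an operator on `H`. -/
def tr (A : H →L[ℂ] H) : ℂ := LinearMap.trace ℂ H (A : H →ₗ[ℂ] H)

/-- `⟨A⟩_ρ = Tr (ρ A)`, a real number for Hermitian `ρ` and `A`. -/
def expect (ρ A : H →L[ℂ] H) : ℝ := (tr (ρ * A)).re

variable (H) in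
/-- The space `S(H)` of strictly positive density operators on `H`. -/
def states : Set (H →L[ℂ] H) :=
  {ρ | ρ.IsPositive ∧ (∀ v : H, v ≠ 0 → 0 < (inner ℂ v (ρ v)).re) ∧ tr ρ = 1}

variable (H) in
/-- The Hermitian operators of trace `0`. As `S(H)` is open in the affine space of Hermitian
operators of trace `1`, this is the tangent space of `S(H)` at each of its points. Tangent vectors
are represented in this way (their m-representation) throughout. -/
def tangent : Set (H →L[ℂ] H) := {A | IsSelfAdjoint A ∧ tr A = 0}

/-- The symmetrized inner product `⟨A, B⟩_ρ = Re Tr (ρ A B)` of Hermitian operators. -/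
def symInner (ρ A B : H →L[ℂ] H) : ℝ := (tr (ρ * A * B)).re

/-- The symmetrized product `ρ ∘ A = (ρ A + A ρ) / 2`. -/
def symProd (ρ A : H →L[ℂ] H) : H →L[ℂ] H := (2⁻¹ : ℝ) • (ρ * A + A * ρ)

/-- The symmetric logarithmic derivative at the state `ρ` of the tangent vector `X`, i.e. the
unique solution `L` of `ρ ∘ L = X` (see `symProd_sld`, `sld_unique` and `sld_isSelfAdjoint`). -/
def sld (ρ X : H →L[ℂ] H) : H →L[ℂ] H := Function.invFun (symProd ρ) X

/-- The SLD metric `g_ρ(X, Y) = ⟨L_X, L_Y⟩_ρ`. -/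
def sldMetric (ρ X Y : H →L[ℂ] H) : ℝ := symInner ρ (sld ρ X) (sld ρ Y)

theorem symProd_injective {ρ : H →L[ℂ] H} (hρ : ρ ∈ states H) :
    Function.Injective (symProd ρ) := by
  have key : ∀ L : H →L[ℂ] H, ρ * L + L * ρ = 0 → L = 0 := by
    intro L hL
    have hs := hρ.1.isSymmetric
    set b := hs.eigenvectorBasis rfl with hb
    have h0 : ∀ i, L (b i) = 0 := by
      intro i
      have hev : ρ (b i) = (hs.eigenvalues rfl i : ℂ) • b i := hs.apply_eigenvectorBasis rfl i
      have hpos : 0 < hs.eigenvalues rfl i := by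
        have h1 := hρ.2.1 (b i) (b.orthonormal.ne_zero i)
        rw [hev, inner_smul_right, inner_self_eq_norm_sq_to_K, b.orthonormal.1 i] at h1
        simpa using h1
      by_contra hne
      have h2 := hρ.2.1 (L (b i)) hne
      have h3 : ρ (L (b i)) + L (ρ (b i)) = 0 := by
        simpa using congrArg (fun T : H →L[ℂ] H => T (b i)) hL
      rw [hev, map_smul] at h3
      rw [eq_neg_of_add_eq_zero_left h3, inner_neg_right, inner_smul_right,
        inner_self_eq_norm_sq_to_K] at h2
      have h4 : (0 : ℝ) ≤ hs.eigenvalues rfl i * ‖L (b i)‖ ^ 2 := by positivity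
      have h5 : (-((hs.eigenvalues rfl i : ℂ) * ((‖L (b i)‖ : ℂ)) ^ 2)).re
          = -(hs.eigenvalues rfl i * ‖L (b i)‖ ^ 2) := by
        rw [Complex.neg_re]
        norm_cast
      have h6 := h2.trans_eq h5
      linarith
    ext v
    rw [← b.sum_repr v]
    simp [h0]
  intro A B hAB
  have h : (2⁻¹ : ℝ) • (ρ * A + A * ρ) = (2⁻¹ : ℝ) • (ρ * B + B * ρ) := hAB
  have h' := smul_right_injective (H →L[ℂ] H) (by norm_num : (2⁻¹ : ℝ) ≠ 0) h
  refine sub_eq_zero.1 (key (A - B) ?_)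
  rw [mul_sub, sub_mul, sub_add_sub_comm]
  exact sub_eq_zero.2 h'

theorem symProd_surjective {ρ : H →L[ℂ] H} (hρ : ρ ∈ states H) :
    Function.Surjective (symProd ρ) := by
  let f : (H →L[ℂ] H) →ₗ[ℝ] (H →L[ℂ] H) :=
    { toFun := symProd ρ
      map_add' := fun A B => by simp only [symProd, mul_add, add_mul, ← smul_add]; congr 1; abel
      map_smul' := fun c A => by
        simp only [symProd, mul_smul_comm, smul_mul_assoc, ← smul_add, RingHom.id_apply]
        rw [smul_comm] }
  have hf : Function.Injective f := symProd_injective hρ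
  exact LinearMap.surjective_of_injective hf

theorem symProd_sld {ρ : H →L[ℂ] H} (hρ : ρ ∈ states H) (X : H →L[ℂ] H) :
    symProd ρ (sld ρ X) = X :=
  Function.invFun_eq (symProd_surjective hρ X)

theorem sld_unique {ρ : H →L[ℂ] H} (hρ : ρ ∈ states H) {X L : H →L[ℂ] H}
    (h : symProd ρ L = X) : sld ρ X = L :=
  symProd_injective hρ ((symProd_sld hρ X).trans h.symm)

theorem sld_isSelfAdjoint {ρ : H →L[ℂ] H} (hρ : ρ ∈ states H) {X : H →L[ℂ] H}
    (hX : IsSelfAdjoint X) : IsSelfAdjoint (sld ρ X) := by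
  refine (sld_unique hρ ?_).symm
  have h : symProd ρ (star (sld ρ X)) = star (symProd ρ (sld ρ X)) := by
    simp only [symProd, star_smul, star_add, star_mul, hρ.1.isSelfAdjoint.star_eq, star_trivial]
    rw [add_comm]
  rw [h, symProd_sld hρ, hX.star_eq]

/-- `A ↦ ⟨A⟩_ρ` as an additive map. -/
def expectHom (ρ : H →L[ℂ] H) : (H →L[ℂ] H) →+ ℝ where
  toFun := expect ρ
  map_zero' := by simp [expect, tr]
  map_add' A B := by simp [expect, tr, mul_add]

theorem continuous_expectHom (ρ : H →L[ℂ] H) : Continuous (expectHom ρ) := by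
  let f : (H →L[ℂ] H) →ₗ[ℂ] ℂ :=
    { toFun := fun A => tr (ρ * A)
      map_add' := fun A B => by simp [tr, mul_add]
      map_smul' := fun c A => by simp [tr] }
  exact Complex.continuous_re.comp f.continuous_of_finiteDimensional

theorem expect_nonneg {ρ P : H →L[ℂ] H} (hρ : ρ.IsPositive) (hP : P.IsPositive) :
    0 ≤ expect ρ P := by
  have hs := hρ.isSymmetric
  set b := hs.eigenvectorBasis rfl with hb
  unfold expect tr
  rw [LinearMap.trace_eq_sum_inner _ b, Complex.re_sum]
  refine Finset.sum_nonneg fun i _ => ?_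
  have hev : ρ (b i) = (hs.eigenvalues rfl i : ℂ) • b i := hs.apply_eigenvectorBasis rfl i
  have hnn : 0 ≤ hs.eigenvalues rfl i := by
    have h1 := hρ.re_inner_nonneg_right (b i)
    rw [hev, inner_smul_right, inner_self_eq_norm_sq_to_K, b.orthonormal.1 i] at h1
    simpa using h1
  have h2 : inner ℂ (b i) (ρ (P (b i))) = (hs.eigenvalues rfl i : ℂ) * inner ℂ (b i) (P (b i)) := by
    have := hs (b i) (P (b i))
    simp only [ContinuousLinearMap.coe_coe] at this
    rw [← this, hev, inner_smul_left, Complex.conj_ofReal]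
  have h3 : 0 ≤ (inner ℂ (b i) (P (b i))).re := hP.re_inner_nonneg_right (b i)
  change 0 ≤ (inner ℂ (b i) (ρ (P (b i)))).re
  rw [h2, Complex.re_ofReal_mul]
  exact mul_nonneg hnn h3
/-! Models -/

variable (H) (n : ℕ) in
/-- An `n`-dimensional model `(M, ξ)` in `S(H)`: a connected submanifold `M` of `S(H)` with a global
coordinate system `ξ`. It is given by the inverse `x ↦ ρ_x` of `ξ`, a smooth injective immersion of
an open subset of `ℝⁿ` into `S(H)`. Thus `M` is the image of `dom` under `point`, and the point
`ρ = point x` of `M` has the coordinates `ξ(ρ) = x`. -/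
structure Model where
  dom : Set (Fin n → ℝ)
  isOpen_dom : IsOpen dom
  isPreconnected_dom : IsPreconnected dom
  point : (Fin n → ℝ) → (H →L[ℂ] H)
  point_mem : ∀ x ∈ dom, point x ∈ states H
  injOn_point : InjOn point dom
  contDiffOn_point : ContDiffOn ℝ ∞ point dom
  injective_fderiv : ∀ x ∈ dom, Function.Injective (fderiv ℝ point x)

/-! Estimators -/

variable (H) (n : ℕ) in
/-- A positive operator-valued measure on `ℝⁿ`: a countably additive map from the Borel sets to the
positive operators on `H`, of total mass `I`. -/
structure POVM where
  toVectorMeasure : VectorMeasure (Fin n → ℝ) (H →L[ℂ] H)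
  isPositive : ∀ s, (toVectorMeasure s).IsPositive
  univ_eq_one : toVectorMeasure univ = 1

/-- `s ↦ Tr (ρ Π(s))` as a signed measure. -/
def POVM.signedOutcome {n : ℕ} (E : POVM H n) (ρ : H →L[ℂ] H) : SignedMeasure (Fin n → ℝ) :=
  E.toVectorMeasure.mapRange (expectHom ρ) (continuous_expectHom ρ)

theorem POVM.signedOutcome_nonneg {n : ℕ} (E : POVM H n) {ρ : H →L[ℂ] H} (hρ : ρ.IsPositive) :
    0 ≤[univ] E.signedOutcome ρ := by
  rw [VectorMeasure.le_restrict_univ_iff_le]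
  intro s _
  exact expect_nonneg hρ (E.isPositive s)

open Classical in
/-- The distribution `Tr (ρ Π(dξ̂))` of the estimate `ξ̂` in the state `ρ`. (The value `0` for
operators `ρ` that are not positive is not used.) -/
def POVM.outcome {n : ℕ} (E : POVM H n) (ρ : H →L[ℂ] H) : Measure (Fin n → ℝ) :=
  if hρ : ρ.IsPositive then
    (E.signedOutcome ρ).toMeasureOfZeroLE univ MeasurableSet.univ (E.signedOutcome_nonneg hρ)
  else 0

variable (H) (n : ℕ) in
/-- An estimator: a POVM on `ℝⁿ` for which the estimate has finite second moments in every state, so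
that its expectation is a vector in `ℝⁿ` and its mean squared error a real `n × n` matrix. -/
structure Estimator extends POVM H n where
  memLp_two : ∀ ρ ∈ states H, ∀ i, MemLp (fun y : Fin n → ℝ => y i) 2 (toPOVM.outcome ρ)

/-- The expectation `E_ρ(Π)`. -/
def Estimator.expectation {n : ℕ} (E : Estimator H n) (ρ : H →L[ℂ] H) (i : Fin n) : ℝ :=
  ∫ y, y i ∂(E.outcome ρ)

namespace Model

variable {n : ℕ} (M : Model H n)

/-- The matrix `V_ρ(Π)` of mean squared errors at `ρ = ρ_x`, where `ξ(ρ) = x`. -/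
def mse (E : Estimator H n) (x : Fin n → ℝ) : Matrix (Fin n) (Fin n) ℝ :=
  Matrix.of fun i j => ∫ y, (y i - x i) * (y j - x j) ∂(E.outcome (M.point x))

/-- The coordinate derivative `∂_j f` at `ρ_x` of a function on `M`, written in coordinates. -/
def partialDeriv {F : Type*} [NormedAddCommGroup F] [NormedSpace ℝ F] (f : (Fin n → ℝ) → F)
    (j : Fin n) (x : Fin n → ℝ) : F :=
  fderiv ℝ f x (Pi.single j 1)

/-- `Π ∈ U(ρ, ξ)` for `ρ = ρ_x`: the estimator `Π` is locally unbiased for `ξ` at `ρ`, i.e.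
`E^i_ρ(Π) = ξ^i(ρ)` and `∂_j E^i_ρ(Π) = δ^i_j`. -/
def IsLocallyUnbiased (E : Estimator H n) (x : Fin n → ℝ) : Prop :=
  (∀ i, E.expectation (M.point x) i = x i) ∧
    ∀ i j, partialDeriv (fun x' => E.expectation (M.point x') i) j x = if i = j then 1 else 0

/-- The SLD Fisher information matrix `G_ρ = [g_ρ(∂_i, ∂_j)]` at `ρ = ρ_x`. -/
def fisher (x : Fin n → ℝ) : Matrix (Fin n) (Fin n) ℝ :=
  Matrix.of fun i j =>
    sldMetric (M.point x) (partialDeriv M.point i x) (partialDeriv M.point j x)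

end Model

variable (H) (n : ℕ) in
/-- A filtration of estimators: a family `(Π_ε)`, `0 < ε < ε₁`, where `0 < ε₁ ≤ ∞`. (Only the values
of `est` at these `ε` are used.) -/
structure EstimatorFiltration where
  bound : EReal
  bound_pos : 0 < bound
  est : ℝ → Estimator H n

namespace Model

variable {n : ℕ} (M : Model H n)

/-- Every `Π_ε` is locally unbiased for `ξ` at `ρ_x`. -/
def IsLocallyUnbiasedFiltration (E : EstimatorFiltration H n) (x : Fin n → ℝ) : Prop :=
  ∀ ε : ℝ, 0 < ε → (ε : EReal) < E.bound → M.IsLocallyUnbiased (E.est ε) x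

/-- The filtration is locally `W`-efficient for `ξ` at `ρ = ρ_x`: every `Π_ε` is in `U(ρ, ξ)`, and
`lim_{ε ↓ 0} tr (W V_ρ(Π_ε))` exists and is at most `tr (W V_ρ(Π'))` for all `Π' ∈ U(ρ, ξ)`. -/
def IsLocallyEfficientFiltration (W : Matrix (Fin n) (Fin n) ℝ) (E : EstimatorFiltration H n)
    (x : Fin n → ℝ) : Prop :=
  M.IsLocallyUnbiasedFiltration E x ∧
    ∃ l : ℝ, Tendsto (fun ε => (W * M.mse (E.est ε) x).trace) (𝓝[>] 0) (𝓝 l) ∧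
      ∀ E' : Estimator H n, M.IsLocallyUnbiased E' x → l ≤ (W * M.mse E' x).trace

/-- The filtration is `W`-efficient for `ξ`: it is locally `W`-efficient at every point of `M`. -/
def IsEfficientFiltration (W : Matrix (Fin n) (Fin n) ℝ) (E : EstimatorFiltration H n) : Prop :=
  ∀ x ∈ M.dom, M.IsLocallyEfficientFiltration W E x

/-! The e- and m-connections

Everything on `M` is written in the coordinates `ξ`: functions and fields along `M` are functions of
`x ∈ M.dom`. -/

/-- `v` is the component function of a smooth vector field `X = ∑ i, v^i ∂_i` on `M`. -/
def IsVectorField (v : (Fin n → ℝ) → (Fin n → ℝ)) : Prop := ContDiffOn ℝ ∞ v M.dom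

/-- The m-representation `ι_*(X)` of the vector field `X = ∑ i, v^i ∂_i`. -/
def push (v : (Fin n → ℝ) → (Fin n → ℝ)) (x : Fin n → ℝ) : H →L[ℂ] H :=
  fderiv ℝ M.point x (v x)

/-- The derivative `X f` along `X = ∑ i, v^i ∂_i` of a function `f` on `M`. For a vector field `Z`
along `M` with values in the tangent spaces of `S(H)`, in m-representation, this is also
the covariant derivative `∇^(m)_X Z` for the m-connection of `S(H)`. -/
def along {F : Type*} [NormedAddCommGroup F] [NormedSpace ℝ F] (v : (Fin n → ℝ) → (Fin n → ℝ))
    (f : (Fin n → ℝ) → F) (x : Fin n → ℝ) : F :=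
  fderiv ℝ f x (v x)

/-- `Z` is a smooth field along `M` of tangent vectors of `S(H)`, in m-representation. -/
def IsFieldAlong (Z : (Fin n → ℝ) → (H →L[ℂ] H)) : Prop :=
  ContDiffOn ℝ ∞ Z M.dom ∧ ∀ x ∈ M.dom, Z x ∈ tangent H

/-- The function `g(Y, Z)` on `M`, for fields `Y`, `Z` along `M` of tangent vectors of `S(H)`. -/
def metric (Y Z : (Fin n → ℝ) → (H →L[ℂ] H)) (x : Fin n → ℝ) : ℝ :=
  sldMetric (M.point x) (Y x) (Z x)

/-- `W = ∇^(e)_X Y`, where `X = ∑ i, v^i ∂_i` is a vector field on `M` and `Y` a field along `M` of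
tangent vectors of `S(H)`. The e-connection is the dual of the m-connection with respect to the
SLD metric: `X g(Y, Z) = g(∇^(e)_X Y, Z) + g(Y, ∇^(m)_X Z)` for all `Z`. As `g` is nondegenerate, this
determines `W` on `M`. For `M = S(H)` this is the definition of the e-connection of `S(H)`, and in
general that of the derivation that it induces on the fields along the submanifold `M`. -/
def IsECovDeriv (v : (Fin n → ℝ) → (Fin n → ℝ)) (Y W : (Fin n → ℝ) → (H →L[ℂ] H)) : Prop :=
  M.IsFieldAlong W ∧ ∀ Z, M.IsFieldAlong Z → ∀ x ∈ M.dom,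
    along v (M.metric Y Z) x = M.metric W Z x + M.metric Y (along v Z) x

/-- `M` is e-autoparallel in `S(H)`: for all vector fields `X`, `Y` on `M`, also `∇^(e)_X Y` is a
vector field on `M`. -/
def IsEAutoparallel : Prop :=
  ∀ v y, M.IsVectorField v → M.IsVectorField y →
    ∃ w, M.IsVectorField w ∧ M.IsECovDeriv v (M.push y) (M.push w)

/-- The vector field with components `w` is `(∇^(m)_M)_X Z`, where `X`, `Z` have the components `v`,
`z`. The m-connection `∇^(m)_M` of `M` is the dual of the e-connection of `M` with respect to the
induced metric: `X g(Y, Z) = g(∇^(e)_X Y, Z) + g(Y, (∇^(m)_M)_X Z)` for all vector fields `Y` on `M`. -/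
def IsMCovDeriv (v z w : (Fin n → ℝ) → (Fin n → ℝ)) : Prop :=
  M.IsVectorField w ∧ ∀ y W, M.IsVectorField y → M.IsECovDeriv v (M.push y) W → ∀ x ∈ M.dom,
    along v (M.metric (M.push y) (M.push z)) x =
      M.metric W (M.push z) x + M.metric (M.push y) (M.push w) x

/-- `ξ` is an m-affine coordinate system of `M`: the coordinate vector fields `∂_j` are parallel for
the m-connection of `M`. -/
def IsMAffine : Prop :=
  ∀ v, M.IsVectorField v → ∀ j : Fin n, M.IsMCovDeriv v (fun _ => Pi.single j 1) (fun _ => 0)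

end Model

end

end QInfoGeom

namespace QInfoGeom

noncomputable section

variable {H : Type*} [NormedAddCommGroup H] [InnerProductSpace ℂ H] [FiniteDimensional ℂ H]
  [CompleteSpace H]

/-! Both conditions are equivalent to a third one, `HasConstantDualSLD`. For u ∈ ℝⁿ put A_u(x) = ⟨u,
x⟩ 1 + L_D, where D = G⁻¹u is the field with g(D, ∂_j) = u_j. The observable A_u(x) is unbiased for
⟨u, ξ⟩ to first order at ρ_x and has variance uᵀG⁻¹u there. The third condition says that A_u(x)
does not depend on x.

Geometry. For a field Z of traceless Hermitian operators, g(D, Z) = Re Tr(Z A_u). If M is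
e-autoparallel and ξ is m-affine, the constancy of g(D, ∂_j) makes D parallel for the e-connection.
Testing this with Z = B - (Tr B)ρ shows that Re Tr(B A_u) has derivative 0 for every Hermitian B, so
A_u is constant on the connected M. Conversely, if the A_u are constant, the product rule yields
tangent e-derivatives, and the fixed values Re Tr(∂_jρ A_i) = δ_ij yield m-affinity.

Estimation. Let T be the first moment of ⟨u, ξ̂⟩ under a locally unbiased estimator. An operator
Jensen inequality (`POVM.expect_mul_self_le_integral_sq`) and Pythagoras (`symInner_eq_of_unbiased`)
give uᵀVu ≥ uᵀG⁻¹u + ‖T - A_u(x)‖², with the norm of ⟨·,·⟩_ρ. Conversely, measuring A_u(x) with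
probability close to 1, and otherwise observables reported in directions orthogonal to u, comes
arbitrarily close to the bound (`exists_estimator_of_observables`). So the bound is the infimum at
every point, which is the last claim of the theorem. Along an efficient filtration T tends to A_u(x)
at every x; as T does not involve x, A_u is constant. If all A_u are constant, the randomized
measurements built at one point are efficient at all points. -/

/-! ### The real trace pairing -/

theorem tr_mul_comm (A B : H →L[ℂ] H) : tr (A * B) = tr (B * A) :=
  LinearMap.trace_mul_comm ℂ (A : H →ₗ[ℂ] H) (B : H →ₗ[ℂ] H)

theorem tr_star (A : H →L[ℂ] H) : tr (star A) = star (tr A) := by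
  have b := stdOrthonormalBasis ℂ H
  unfold tr
  rw [LinearMap.trace_eq_sum_inner _ b, LinearMap.trace_eq_sum_inner _ b, star_sum]
  refine Finset.sum_congr rfl fun i _ => ?_
  simp only [ContinuousLinearMap.coe_coe, ContinuousLinearMap.star_eq_adjoint,
    ContinuousLinearMap.adjoint_inner_right]
  exact (inner_conj_symm _ _).symm

variable (H) in
/-- The trace as a real-linear map into `ℂ`. -/
def trLin : (H →L[ℂ] H) →ₗ[ℝ] ℂ where
  toFun := tr
  map_add' A B := by simp [tr]
  map_smul' c A := by
    have : ((c • A : H →L[ℂ] H) : H →ₗ[ℂ] H) = (c : ℂ) • (A : H →ₗ[ℂ] H) := by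
      ext; simp
    simp [tr, this]

variable (H) in
/-- The pairing `(A, B) ↦ Re Tr (A B)` as a real-bilinear map. -/
def expectLin : (H →L[ℂ] H) →ₗ[ℝ] (H →L[ℂ] H) →ₗ[ℝ] ℝ :=
  (LinearMap.mul ℝ (H →L[ℂ] H)).compr₂ (Complex.reLm ∘ₗ trLin H)

theorem expectLin_apply (A B : H →L[ℂ] H) : expectLin H A B = expect A B := rfl

theorem expect_comm (A B : H →L[ℂ] H) : expect A B = expect B A := by
  simp only [expect, tr_mul_comm A B]

theorem expect_add_left (A B C : H →L[ℂ] H) : expect (A + B) C = expect A C + expect B C := by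
  simp only [← expectLin_apply, map_add, LinearMap.add_apply]

theorem expect_add_right (A B C : H →L[ℂ] H) : expect A (B + C) = expect A B + expect A C := by
  simp only [← expectLin_apply, map_add]

theorem expect_sub_left (A B C : H →L[ℂ] H) : expect (A - B) C = expect A C - expect B C := by
  simp only [← expectLin_apply, map_sub, LinearMap.sub_apply]

theorem expect_sub_right (A B C : H →L[ℂ] H) : expect A (B - C) = expect A B - expect A C := by
  simp only [← expectLin_apply, map_sub]

theorem expect_smul_left (c : ℝ) (A B : H →L[ℂ] H) : expect (c • A) B = c * expect A B := by
  simp only [← expectLin_apply, map_smul, LinearMap.smul_apply, smul_eq_mul]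

theorem expect_smul_right (c : ℝ) (A B : H →L[ℂ] H) : expect A (c • B) = c * expect A B := by
  simp only [← expectLin_apply, map_smul, smul_eq_mul]

theorem expect_zero_left (A : H →L[ℂ] H) : expect 0 A = 0 := by
  simp only [← expectLin_apply, map_zero, LinearMap.zero_apply]

theorem expect_zero_right (A : H →L[ℂ] H) : expect A 0 = 0 := by
  simp only [← expectLin_apply, map_zero]

theorem expect_sum_left {ι : Type*} (s : Finset ι) (f : ι → H →L[ℂ] H) (A : H →L[ℂ] H) :
    expect (∑ i ∈ s, f i) A = ∑ i ∈ s, expect (f i) A := by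
  simp only [← expectLin_apply, map_sum, LinearMap.sum_apply]

theorem expect_sum_right {ι : Type*} (s : Finset ι) (f : ι → H →L[ℂ] H) (A : H →L[ℂ] H) :
    expect A (∑ i ∈ s, f i) = ∑ i ∈ s, expect A (f i) := by
  simp only [← expectLin_apply, map_sum]

theorem expect_one_right (A : H →L[ℂ] H) : expect A 1 = (tr A).re := by simp [expect]

theorem expect_star (A B : H →L[ℂ] H) : expect (star A) (star B) = expect A B := by
  simp only [expect, ← star_mul, tr_star, tr_mul_comm B A]
  exact Complex.conj_re _

/-- `X ↦ Re Tr (X A)` as a continuous linear map. -/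
def expectCLM (A : H →L[ℂ] H) : (H →L[ℂ] H) →L[ℝ] ℝ :=
  LinearMap.toContinuousLinearMap ((expectLin H).flip A)

theorem expectCLM_apply (A X : H →L[ℂ] H) : expectCLM A X = expect X A := rfl

theorem expect_star_mul_self (A : H →L[ℂ] H) {ι : Type*} [Fintype ι]
    (b : OrthonormalBasis ι ℂ H) : expect (star A) A = ∑ i, ‖A (b i)‖ ^ 2 := by
  unfold expect tr
  rw [LinearMap.trace_eq_sum_inner _ b, Complex.re_sum]
  refine Finset.sum_congr rfl fun i _ => ?_
  change (inner ℂ (b i) ((star A) (A (b i)))).re = _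
  rw [ContinuousLinearMap.star_eq_adjoint, ContinuousLinearMap.adjoint_inner_right,
    inner_self_eq_norm_sq_to_K]
  norm_cast

theorem expect_star_self_eq_zero {A : H →L[ℂ] H} (h : expect (star A) A = 0) : A = 0 := by
  have b := stdOrthonormalBasis ℂ H
  rw [expect_star_mul_self A b, Finset.sum_eq_zero_iff_of_nonneg fun i _ => by positivity] at h
  have hz : ∀ i, A (b i) = 0 := fun i => by simpa using h i (Finset.mem_univ i)
  ext v
  rw [← b.sum_repr v]
  simp [hz]

/-- Every real-linear functional on Hermitian operators is `X ↦ Re Tr (X T)` for a Hermitian `T`. -/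
theorem exists_isSelfAdjoint_expect_eq (φ : (H →L[ℂ] H) →ₗ[ℝ] ℝ) :
    ∃ T : H →L[ℂ] H, IsSelfAdjoint T ∧ ∀ X, IsSelfAdjoint X → φ X = expect X T := by
  have hinj : Function.Injective (expectLin H).flip := by
    rw [injective_iff_map_eq_zero]
    intro T hT
    exact expect_star_self_eq_zero (LinearMap.congr_fun hT (star T))
  have hfin : Module.finrank ℝ (H →L[ℂ] H) = Module.finrank ℝ ((H →L[ℂ] H) →ₗ[ℝ] ℝ) :=
    (Subspace.dual_finrank_eq (K := ℝ) (V := H →L[ℂ] H)).symm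
  obtain ⟨T, hT⟩ := (LinearMap.injective_iff_surjective_of_finrank_eq_finrank hfin).1 hinj φ
  -- Hermitian X do not see the anti-Hermitian part of T, so T may be replaced by its Hermitian
  -- part.
  refine ⟨(2⁻¹ : ℝ) • (T + star T), ?_, fun X hX => ?_⟩
  · rw [IsSelfAdjoint, star_smul, star_add, star_star, star_trivial, add_comm]
  · have h1 : expect X (star T) = expect X T := by
      conv_lhs => rw [← hX.star_eq]
      exact expect_star X T
    rw [expect_smul_right, expect_add_right, h1, ← hT]
    change expect X T = _
    ring

theorem isSelfAdjoint_sum_smul {ι : Type*} [Fintype ι] {T : ι → H →L[ℂ] H}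
    (hT : ∀ i, IsSelfAdjoint (T i)) (u : ι → ℝ) : IsSelfAdjoint (∑ i, u i • T i) := by
  rw [IsSelfAdjoint, star_sum]
  exact Finset.sum_congr rfl fun i _ => by rw [star_smul, star_trivial, (hT i).star_eq]

/-! ### The inner product at a state, and the SLD -/

theorem symInner_eq_expect_mul (ρ A B : H →L[ℂ] H) : symInner ρ A B = expect ρ (A * B) := by
  simp only [symInner, expect, mul_assoc]

/-- The real part of the trace is invariant under adjoints, so both halves of `symProd ρ A` pair
with B to the same number. This turns g(X, Y) into Re Tr(X L_Y), in which only one SLD occurs. -/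
theorem symInner_eq {ρ A B : H →L[ℂ] H} (hρ : IsSelfAdjoint ρ) (hA : IsSelfAdjoint A)
    (hB : IsSelfAdjoint B) : symInner ρ A B = expect (symProd ρ A) B := by
  have h : expect (A * ρ) B = expect (ρ * A) B := by
    conv_lhs => rw [← expect_star, star_mul, hρ.star_eq, hA.star_eq, hB.star_eq]
  rw [symProd, expect_smul_left, expect_add_left, h]
  change expect (ρ * A) B = _
  ring

theorem symInner_comm {ρ A B : H →L[ℂ] H} (hρ : IsSelfAdjoint ρ) (hA : IsSelfAdjoint A)
    (hB : IsSelfAdjoint B) : symInner ρ A B = symInner ρ B A := by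
  rw [symInner_eq_expect_mul, symInner_eq_expect_mul, ← expect_star, star_mul, hρ.star_eq,
    hA.star_eq, hB.star_eq]

variable (H) in
/-- The symmetrized product as a continuous bilinear map. -/
def symProdCLM : (H →L[ℂ] H) →L[ℝ] (H →L[ℂ] H) →L[ℝ] (H →L[ℂ] H) :=
  (2⁻¹ : ℝ) • (ContinuousLinearMap.mul ℝ (H →L[ℂ] H) +
    (ContinuousLinearMap.mul ℝ (H →L[ℂ] H)).flip)

theorem symProdCLM_apply (ρ A : H →L[ℂ] H) : symProdCLM H ρ A = symProd ρ A := by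
  simp [symProdCLM, symProd]

theorem isInvertible_symProdCLM {ρ : H →L[ℂ] H} (hρ : ρ ∈ states H) :
    (symProdCLM H ρ).IsInvertible := by
  have hb : Function.Bijective (symProdCLM H ρ : (H →L[ℂ] H) →ₗ[ℝ] (H →L[ℂ] H)) := by
    have : ⇑(symProdCLM H ρ : (H →L[ℂ] H) →ₗ[ℝ] (H →L[ℂ] H)) = symProd ρ :=
      funext fun A => symProdCLM_apply ρ A
    rw [this]
    exact ⟨symProd_injective hρ, symProd_surjective hρ⟩
  exact ⟨(LinearEquiv.ofBijective _ hb).toContinuousLinearEquiv, by ext; rfl⟩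

/-- As the inverse of a map depending linearly on ρ, the SLD is visibly linear in X and smooth in ρ.
-/
theorem sld_eq_inverse {ρ : H →L[ℂ] H} (hρ : ρ ∈ states H) (X : H →L[ℂ] H) :
    sld ρ X = (symProdCLM H ρ).inverse X := by
  refine sld_unique hρ ?_
  rw [← symProdCLM_apply]
  exact (isInvertible_symProdCLM hρ).self_apply_inverse X

theorem sldMetric_eq_left {ρ X Y : H →L[ℂ] H} (hρ : ρ ∈ states H) (hX : IsSelfAdjoint X)
    (hY : IsSelfAdjoint Y) : sldMetric ρ X Y = expect X (sld ρ Y) := by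
  rw [sldMetric, symInner_eq hρ.1.isSelfAdjoint (sld_isSelfAdjoint hρ hX)
    (sld_isSelfAdjoint hρ hY), symProd_sld hρ]

theorem sldMetric_comm {ρ X Y : H →L[ℂ] H} (hρ : ρ ∈ states H) (hX : IsSelfAdjoint X)
    (hY : IsSelfAdjoint Y) : sldMetric ρ X Y = sldMetric ρ Y X :=
  symInner_comm hρ.1.isSelfAdjoint (sld_isSelfAdjoint hρ hX) (sld_isSelfAdjoint hρ hY)

theorem sldMetric_eq_right {ρ X Y : H →L[ℂ] H} (hρ : ρ ∈ states H) (hX : IsSelfAdjoint X)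
    (hY : IsSelfAdjoint Y) : sldMetric ρ X Y = expect (sld ρ X) Y := by
  rw [sldMetric_comm hρ hX hY, sldMetric_eq_left hρ hY hX, expect_comm]

/-- A state is a mixture with positive weights of an orthonormal basis. -/
theorem exists_expect_eq_sum {ρ : H →L[ℂ] H} (hρ : ρ ∈ states H) :
    ∃ (b : OrthonormalBasis (Fin (Module.finrank ℂ H)) ℂ H) (p : Fin (Module.finrank ℂ H) → ℝ),
      (∀ i, 0 < p i) ∧ ∀ P, expect ρ P = ∑ i, p i * (inner ℂ (b i) (P (b i))).re := by
  have hs := hρ.1.isSymmetric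
  refine ⟨hs.eigenvectorBasis rfl, hs.eigenvalues rfl, fun i => ?_, fun P => ?_⟩
  all_goals
    set b := hs.eigenvectorBasis rfl with hb
    have hev : ∀ i, ρ (b i) = (hs.eigenvalues rfl i : ℂ) • b i :=
      fun i => hs.apply_eigenvectorBasis rfl i
  · have h1 := hρ.2.1 (b i) (b.orthonormal.ne_zero i)
    rw [hev, inner_smul_right, inner_self_eq_norm_sq_to_K, b.orthonormal.1 i] at h1
    simpa using h1
  · unfold expect tr
    rw [LinearMap.trace_eq_sum_inner _ b, Complex.re_sum]
    refine Finset.sum_congr rfl fun i _ => ?_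
    have := hs (b i) (P (b i))
    simp only [ContinuousLinearMap.coe_coe] at this
    change (inner ℂ (b i) (ρ (P (b i)))).re = _
    rw [← this, hev, inner_smul_left, Complex.conj_ofReal, Complex.re_ofReal_mul]

theorem exists_symInner_self_eq_sum {ρ : H →L[ℂ] H} (hρ : ρ ∈ states H) :
    ∃ (b : OrthonormalBasis (Fin (Module.finrank ℂ H)) ℂ H) (p : Fin (Module.finrank ℂ H) → ℝ),
      (∀ i, 0 < p i) ∧
        ∀ B, IsSelfAdjoint B → symInner ρ B B = ∑ i, p i * ‖B (b i)‖ ^ 2 := by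
  obtain ⟨b, p, hp, h⟩ := exists_expect_eq_sum hρ
  refine ⟨b, p, hp, fun B hB => ?_⟩
  rw [symInner_eq_expect_mul, h]
  refine Finset.sum_congr rfl fun i _ => ?_
  congr 1
  change (inner ℂ (b i) (B (B (b i)))).re = _
  have := hB.isSymmetric (b i) (B (b i))
  simp only [ContinuousLinearMap.coe_coe] at this
  rw [← this, inner_self_eq_norm_sq_to_K]
  norm_cast

theorem symInner_self_nonneg {ρ B : H →L[ℂ] H} (hρ : ρ ∈ states H) (hB : IsSelfAdjoint B) :
    0 ≤ symInner ρ B B := by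
  obtain ⟨b, p, hp, h⟩ := exists_symInner_self_eq_sum hρ
  rw [h B hB]
  exact Finset.sum_nonneg fun i _ => mul_nonneg (hp i).le (by positivity)

/-- Convergence to `0` for the inner product `⟨·, ·⟩_ρ` implies strong convergence to `0`. -/
theorem tendsto_apply_of_tendsto_symInner {ρ : H →L[ℂ] H} (hρ : ρ ∈ states H) {α : Type*}
    {l : Filter α} {B : α → H →L[ℂ] H} (hB : ∀ a, IsSelfAdjoint (B a))
    (h : Tendsto (fun a => symInner ρ (B a) (B a)) l (𝓝 0)) (v : H) :
    Tendsto (fun a => B a v) l (𝓝 0) := by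
  obtain ⟨b, p, hp, hsum⟩ := exists_symInner_self_eq_sum hρ
  have hb : ∀ i, Tendsto (fun a => B a (b i)) l (𝓝 0) := by
    intro i
    rw [tendsto_zero_iff_norm_tendsto_zero]
    have h1 : Tendsto (fun a => ‖B a (b i)‖ ^ 2) l (𝓝 0) := by
      refine squeeze_zero (fun a => by positivity) (fun a => ?_)
        (by simpa using h.const_mul (p i)⁻¹)
      rw [hsum _ (hB a), inv_mul_eq_div, le_div_iff₀ (hp i), mul_comm]
      exact Finset.single_le_sum (f := fun i => p i * ‖B a (b i)‖ ^ 2)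
        (fun j _ => mul_nonneg (hp j).le (by positivity)) (Finset.mem_univ i)
    have h2 := (Real.continuous_sqrt.tendsto 0).comp h1
    simpa [Function.comp_def] using h2
  have h3 : ∀ a, B a v = ∑ i, b.repr v i • B a (b i) := fun a => by
    conv_lhs => rw [← b.sum_repr v]
    simp
  simp only [h3]
  have := tendsto_finsetSum Finset.univ fun i _ => (hb i).const_smul (b.repr v i)
  simpa using this

theorem symInner_self_eq_zero {ρ B : H →L[ℂ] H} (hρ : ρ ∈ states H) (hB : IsSelfAdjoint B)
    (h : symInner ρ B B = 0) : B = 0 := by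
  ext v
  -- Definiteness is the case of a constant family in the convergence lemma.
  have := tendsto_apply_of_tendsto_symInner hρ (l := (pure () : Filter Unit)) (B := fun _ => B)
    (fun _ => hB) (by rw [h]; exact tendsto_const_nhds) v
  exact tendsto_nhds_unique tendsto_const_nhds this

theorem isSelfAdjoint_fderiv {E : Type*} [NormedAddCommGroup E] [NormedSpace ℝ E]
    {Z : E → H →L[ℂ] H} {x : E} (hZ : DifferentiableAt ℝ Z x)
    (h : ∀ᶠ y in 𝓝 x, IsSelfAdjoint (Z y)) (v : E) : IsSelfAdjoint (fderiv ℝ Z x v) := by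
  have h1 := hZ.hasFDerivAt.star
  have h2 : (fun y => star (Z y)) =ᶠ[𝓝 x] Z := h.mono fun y hy => hy.star_eq
  have h3 := (h1.congr_of_eventuallyEq h2.symm).unique hZ.hasFDerivAt
  have h4 := DFunLike.congr_fun h3 v
  simpa [IsSelfAdjoint] using h4

theorem tr_fderiv_eq_zero {E : Type*} [NormedAddCommGroup E] [NormedSpace ℝ E]
    {Z : E → H →L[ℂ] H} {x : E} {c : ℂ} (hZ : DifferentiableAt ℝ Z x)
    (h : ∀ᶠ y in 𝓝 x, tr (Z y) = c) (v : E) : tr (fderiv ℝ Z x v) = 0 := by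
  have h1 := (LinearMap.toContinuousLinearMap (trLin H)).hasFDerivAt.comp x hZ.hasFDerivAt
  have h2 : (fun y => tr (Z y)) =ᶠ[𝓝 x] fun _ => c := h
  have h3 := (h1.congr_of_eventuallyEq h2.symm).unique (hasFDerivAt_const c x)
  exact DFunLike.congr_fun h3 v

theorem fderiv_expect {E : Type*} [NormedAddCommGroup E] [NormedSpace ℝ E]
    {Z : E → H →L[ℂ] H} {x : E} (hZ : DifferentiableAt ℝ Z x) (A : H →L[ℂ] H) :
    HasFDerivAt (fun y => expect (Z y) A) (expectCLM A ∘L fderiv ℝ Z x) x :=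
  (expectCLM A).hasFDerivAt.comp x hZ.hasFDerivAt

/-! ### The Fisher matrix and the dual observables -/

namespace Model

variable {n : ℕ} (M : Model H n)

theorem eventually_mem_dom {x : Fin n → ℝ} (hx : x ∈ M.dom) : ∀ᶠ y in 𝓝 x, y ∈ M.dom :=
  M.isOpen_dom.mem_nhds hx

theorem differentiableAt_of_contDiffOn {F : Type*} [NormedAddCommGroup F] [NormedSpace ℝ F]
    {f : (Fin n → ℝ) → F} (hf : ContDiffOn ℝ ∞ f M.dom) {x : Fin n → ℝ} (hx : x ∈ M.dom) :
    DifferentiableAt ℝ f x :=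
  (hf.contDiffAt (M.isOpen_dom.mem_nhds hx)).differentiableAt (by simp)

theorem contDiffOn_along {F : Type*} [NormedAddCommGroup F] [NormedSpace ℝ F]
    {f : (Fin n → ℝ) → F} (hf : ContDiffOn ℝ ∞ f M.dom) {v : (Fin n → ℝ) → (Fin n → ℝ)}
    (hv : M.IsVectorField v) : ContDiffOn ℝ ∞ (along v f) M.dom :=
  (hf.fderiv_of_isOpen M.isOpen_dom (by simp)).clm_apply hv

theorem differentiableAt_point {x : Fin n → ℝ} (hx : x ∈ M.dom) : DifferentiableAt ℝ M.point x :=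
  M.differentiableAt_of_contDiffOn M.contDiffOn_point hx

theorem isSelfAdjoint_deriv {x : Fin n → ℝ} (hx : x ∈ M.dom) (v : Fin n → ℝ) :
    IsSelfAdjoint (fderiv ℝ M.point x v) :=
  isSelfAdjoint_fderiv (M.differentiableAt_point hx)
    ((M.eventually_mem_dom hx).mono fun y hy => (M.point_mem y hy).1.isSelfAdjoint) v

theorem tr_deriv {x : Fin n → ℝ} (hx : x ∈ M.dom) (v : Fin n → ℝ) :
    tr (fderiv ℝ M.point x v) = 0 :=
  tr_fderiv_eq_zero (M.differentiableAt_point hx)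
    ((M.eventually_mem_dom hx).mono fun y hy => (M.point_mem y hy).2.2) v

theorem IsVectorField.isFieldAlong_push {M : Model H n} {y : (Fin n → ℝ) → (Fin n → ℝ)}
    (hy : M.IsVectorField y) : M.IsFieldAlong (M.push y) :=
  ⟨M.contDiffOn_along M.contDiffOn_point hy,
    fun _ hx => ⟨M.isSelfAdjoint_deriv hx _, M.tr_deriv hx _⟩⟩

theorem IsFieldAlong.along_mem_tangent {M : Model H n} {Z : (Fin n → ℝ) → H →L[ℂ] H}
    (hZ : M.IsFieldAlong Z) (v : (Fin n → ℝ) → (Fin n → ℝ)) {x : Fin n → ℝ} (hx : x ∈ M.dom) :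
    along v Z x ∈ tangent H :=
  ⟨isSelfAdjoint_fderiv (M.differentiableAt_of_contDiffOn hZ.1 hx)
      ((M.eventually_mem_dom hx).mono fun y hy => (hZ.2 y hy).1) _,
    tr_fderiv_eq_zero (M.differentiableAt_of_contDiffOn hZ.1 hx)
      ((M.eventually_mem_dom hx).mono fun y hy => (hZ.2 y hy).2) _⟩

theorem contDiffOn_sld {Y : (Fin n → ℝ) → H →L[ℂ] H} (hY : ContDiffOn ℝ ∞ Y M.dom) :
    ContDiffOn ℝ ∞ (fun x => sld (M.point x) (Y x)) M.dom := by
  have h1 : ContDiffOn ℝ ∞ (fun x => (symProdCLM H (M.point x)).inverse) M.dom := by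
    intro x hx
    have h2 := (isInvertible_symProdCLM (M.point_mem x hx)).contDiffAt_map_inverse (n := ∞)
    exact h2.comp_contDiffWithinAt x
      ((symProdCLM H).contDiff.contDiffAt.comp_contDiffWithinAt x (M.contDiffOn_point x hx))
  exact (h1.clm_apply hY).congr fun x hx => sld_eq_inverse (M.point_mem x hx) _

theorem metric_eq_expect {Y Z : (Fin n → ℝ) → H →L[ℂ] H} {x : Fin n → ℝ} (hx : x ∈ M.dom)
    (hY : Y x ∈ tangent H) (hZ : Z x ∈ tangent H) :
    M.metric Y Z x = expect (sld (M.point x) (Y x)) (Z x) :=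
  sldMetric_eq_right (M.point_mem x hx) hY.1 hZ.1

/-- The SLD of the tangent vector with components `v` at `ρ_x`. -/
def tangentSLD (x v : Fin n → ℝ) : H →L[ℂ] H := sld (M.point x) (fderiv ℝ M.point x v)

theorem isSelfAdjoint_tangentSLD {x : Fin n → ℝ} (hx : x ∈ M.dom) (v : Fin n → ℝ) :
    IsSelfAdjoint (M.tangentSLD x v) :=
  sld_isSelfAdjoint (M.point_mem x hx) (M.isSelfAdjoint_deriv hx v)

theorem symProd_tangentSLD {x : Fin n → ℝ} (hx : x ∈ M.dom) (v : Fin n → ℝ) :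
    symProd (M.point x) (M.tangentSLD x v) = fderiv ℝ M.point x v :=
  symProd_sld (M.point_mem x hx) _

theorem tangentSLD_sum {ι : Type*} {x : Fin n → ℝ} (hx : x ∈ M.dom) (s : Finset ι)
    (c : ι → ℝ) (v : ι → Fin n → ℝ) :
    M.tangentSLD x (∑ i ∈ s, c i • v i) = ∑ i ∈ s, c i • M.tangentSLD x (v i) := by
  simp only [tangentSLD, sld_eq_inverse (M.point_mem x hx), map_sum, map_smul]

/-- Pairing ρ ∘ L = X with the identity gives Tr(ρL) = Tr X = 0. -/
theorem expect_point_tangentSLD {x : Fin n → ℝ} (hx : x ∈ M.dom) (v : Fin n → ℝ) :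
    expect (M.point x) (M.tangentSLD x v) = 0 := by
  have h1 := symInner_eq (M.point_mem x hx).1.isSelfAdjoint (M.isSelfAdjoint_tangentSLD hx v)
    (IsSelfAdjoint.one (H →L[ℂ] H))
  rw [M.symProd_tangentSLD hx, expect_one_right, M.tr_deriv hx, symInner_eq_expect_mul,
    mul_one] at h1
  exact h1

theorem sum_smul_single (v : Fin n → ℝ) : ∑ i, v i • (Pi.single i 1 : Fin n → ℝ) = v := by
  ext j
  simp [Pi.single_apply]

theorem fisher_mulVec {x : Fin n → ℝ} (hx : x ∈ M.dom) (v : Fin n → ℝ) (i : Fin n) :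
    (M.fisher x).mulVec v i =
      expect (fderiv ℝ M.point x (Pi.single i 1)) (M.tangentSLD x v) := by
  conv_rhs => rw [← sum_smul_single v]
  rw [M.tangentSLD_sum hx, expect_sum_right, Matrix.mulVec, dotProduct]
  refine Finset.sum_congr rfl fun j _ => ?_
  rw [expect_smul_right, fisher, Matrix.of_apply, partialDeriv, partialDeriv,
    sldMetric_eq_left (M.point_mem x hx) (M.isSelfAdjoint_deriv hx _) (M.isSelfAdjoint_deriv hx _),
    mul_comm, tangentSLD]

theorem dotProduct_fisher_mulVec {x : Fin n → ℝ} (hx : x ∈ M.dom) (v w : Fin n → ℝ) :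
    v ⬝ᵥ (M.fisher x).mulVec w = expect (fderiv ℝ M.point x v) (M.tangentSLD x w) := by
  conv_rhs => rw [← sum_smul_single v]
  simp only [dotProduct, M.fisher_mulVec hx, map_sum, map_smul, expect_sum_left, expect_smul_left]

/-- If Gv = 0, then ⟨L_v, L_v⟩_ρ = vᵀGv = 0, hence L_v = 0 and the derivative of ρ along v vanishes;
the immersion property gives v = 0. -/
theorem isUnit_fisher {x : Fin n → ℝ} (hx : x ∈ M.dom) : IsUnit (M.fisher x) := by
  rw [← Matrix.mulVec_injective_iff_isUnit]
  refine (injective_iff_map_eq_zero (M.fisher x).mulVecLin).2 fun v hv => ?_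
  have hv' : (M.fisher x).mulVec v = 0 := hv
  have h1 := M.dotProduct_fisher_mulVec hx v v
  rw [hv', dotProduct_zero, ← M.symProd_tangentSLD hx,
    ← symInner_eq (M.point_mem x hx).1.isSelfAdjoint (M.isSelfAdjoint_tangentSLD hx v)
      (M.isSelfAdjoint_tangentSLD hx v)] at h1
  have h2 := symInner_self_eq_zero (M.point_mem x hx) (M.isSelfAdjoint_tangentSLD hx v) h1.symm
  have h3 := M.symProd_tangentSLD hx v
  rw [h2] at h3
  refine M.injective_fderiv x hx ?_
  rw [← h3, map_zero]
  simp [symProd]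

theorem isUnit_det_fisher {x : Fin n → ℝ} (hx : x ∈ M.dom) : IsUnit (M.fisher x).det :=
  (Matrix.isUnit_iff_isUnit_det _).1 (M.isUnit_fisher hx)

theorem fisher_mulVec_inv_mulVec {x : Fin n → ℝ} (hx : x ∈ M.dom) (u : Fin n → ℝ) :
    (M.fisher x).mulVec ((M.fisher x)⁻¹.mulVec u) = u := by
  rw [Matrix.mulVec_mulVec, Matrix.mul_nonsing_inv _ (M.isUnit_det_fisher hx), Matrix.one_mulVec]

theorem inv_mulVec_fisher_mulVec {x : Fin n → ℝ} (hx : x ∈ M.dom) (u : Fin n → ℝ) :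
    (M.fisher x)⁻¹.mulVec ((M.fisher x).mulVec u) = u := by
  rw [Matrix.mulVec_mulVec, Matrix.nonsing_inv_mul _ (M.isUnit_det_fisher hx), Matrix.one_mulVec]

theorem contDiffOn_fisher_apply (i j : Fin n) :
    ContDiffOn ℝ ∞ (fun x => M.fisher x i j) M.dom := by
  have h1 : ∀ k : Fin n, ContDiffOn ℝ ∞ (fun x => fderiv ℝ M.point x (Pi.single k 1)) M.dom :=
    fun k => M.contDiffOn_along M.contDiffOn_point (v := fun _ => Pi.single k 1) contDiffOn_const
  have h2 := (((LinearMap.toContinuousLinearMap (Complex.reLm ∘ₗ trLin H)).contDiff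
    (n := ∞)).comp_contDiffOn ((h1 i).mul (M.contDiffOn_sld (h1 j))))
  refine h2.congr fun x hx => ?_
  rw [fisher, Matrix.of_apply, partialDeriv, partialDeriv,
    sldMetric_eq_left (M.point_mem x hx) (M.isSelfAdjoint_deriv hx _) (M.isSelfAdjoint_deriv hx _)]
  rfl

theorem contDiffOn_fisher_mulVec {y : (Fin n → ℝ) → (Fin n → ℝ)} (hy : M.IsVectorField y) :
    ContDiffOn ℝ ∞ (fun x => (M.fisher x).mulVec (y x)) M.dom := by
  rw [contDiffOn_pi]
  intro i
  simp only [Matrix.mulVec, dotProduct]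
  exact ContDiffOn.sum fun j _ => (M.contDiffOn_fisher_apply i j).mul (contDiffOn_pi.1 hy j)

theorem contDiffOn_det {s : Set (Fin n → ℝ)} {A : (Fin n → ℝ) → Matrix (Fin n) (Fin n) ℝ}
    (hA : ∀ i j, ContDiffOn ℝ ∞ (fun x => A x i j) s) :
    ContDiffOn ℝ ∞ (fun x => (A x).det) s := by
  simp only [Matrix.det_apply]
  exact ContDiffOn.sum fun σ _ =>
    (contDiffOn_prod fun i _ => hA (σ i) i).const_smul ((Equiv.Perm.sign σ : ℤˣ))

theorem contDiffOn_inv_fisher_mulVec {y : (Fin n → ℝ) → (Fin n → ℝ)} (hy : M.IsVectorField y) :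
    M.IsVectorField (fun x => (M.fisher x)⁻¹.mulVec (y x)) := by
  rw [IsVectorField, contDiffOn_pi]
  intro i
  -- Cramer's rule: the components are quotients of determinants with smooth entries.
  have h1 : ContDiffOn ℝ ∞ (fun x => ((M.fisher x).det)⁻¹ *
      ((M.fisher x).updateCol i (y x)).det) M.dom := by
    refine ((contDiffOn_det M.contDiffOn_fisher_apply).inv
      fun x hx => (M.isUnit_det_fisher hx).ne_zero).mul (contDiffOn_det fun k l => ?_)
    by_cases h : l = i
    · subst h
      simpa using contDiffOn_pi.1 hy k
    · simpa [Matrix.updateCol_apply, h] using M.contDiffOn_fisher_apply k l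
  refine h1.congr fun x hx => ?_
  rw [Matrix.inv_def, Matrix.smul_mulVec, ← Matrix.cramer_eq_adjugate_mulVec, Pi.smul_apply,
    Matrix.cramer_apply, Ring.inverse_eq_inv', smul_eq_mul]

/-- The observable `⟨u, ξ⟩ + ∑ u_i G^{ij} L_j` at `ρ_x`, which is the unique efficient unbiased
observable for `⟨u, ξ⟩` at that point. -/
def dualSLD (u x : Fin n → ℝ) : H →L[ℂ] H :=
  (u ⬝ᵥ x) • 1 + M.tangentSLD x ((M.fisher x)⁻¹.mulVec u)

theorem isSelfAdjoint_dualSLD (u : Fin n → ℝ) {x : Fin n → ℝ} (hx : x ∈ M.dom) :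
    IsSelfAdjoint (M.dualSLD u x) :=
  ((IsSelfAdjoint.all (u ⬝ᵥ x)).smul (IsSelfAdjoint.one _)).add (M.isSelfAdjoint_tangentSLD hx _)

theorem expect_one_of_mem_states {ρ : H →L[ℂ] H} (hρ : ρ ∈ states H) : expect ρ 1 = 1 := by
  rw [expect_one_right, hρ.2.2, Complex.one_re]

theorem expect_point_dualSLD (u : Fin n → ℝ) {x : Fin n → ℝ} (hx : x ∈ M.dom) :
    expect (M.point x) (M.dualSLD u x) = u ⬝ᵥ x := by
  rw [dualSLD, expect_add_right, expect_smul_right, expect_one_of_mem_states (M.point_mem x hx),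
    M.expect_point_tangentSLD hx, mul_one, add_zero]

theorem expect_deriv_dualSLD (u v : Fin n → ℝ) {x : Fin n → ℝ} (hx : x ∈ M.dom) :
    expect (fderiv ℝ M.point x v) (M.dualSLD u x) = v ⬝ᵥ u := by
  rw [dualSLD, expect_add_right, expect_smul_right, expect_one_right, M.tr_deriv hx,
    ← M.dotProduct_fisher_mulVec hx, M.fisher_mulVec_inv_mulVec hx]
  simp

theorem dualSLD_eq_sum (u : Fin n → ℝ) {x : Fin n → ℝ} (hx : x ∈ M.dom) :
    M.dualSLD u x = ∑ i, u i • M.dualSLD (Pi.single i 1) x := by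
  have h1 : (M.fisher x)⁻¹.mulVec u = ∑ i, u i • (M.fisher x)⁻¹.mulVec (Pi.single i 1) := by
    conv_lhs => rw [← sum_smul_single u, Matrix.mulVec_sum]
    simp only [Matrix.mulVec_smul]
  simp only [dualSLD, h1, M.tangentSLD_sum hx, smul_add, Finset.sum_add_distrib, smul_smul,
    ← Finset.sum_smul, single_dotProduct, one_mul]
  rfl

theorem tangentSLD_eq {x : Fin n → ℝ} (hx : x ∈ M.dom) (v : Fin n → ℝ) :
    M.tangentSLD x v =
      M.dualSLD ((M.fisher x).mulVec v) x - ((M.fisher x).mulVec v ⬝ᵥ x) • 1 := by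
  rw [dualSLD, M.inv_mulVec_fisher_mulVec hx, add_sub_cancel_left]

theorem metric_push_push {y z : (Fin n → ℝ) → (Fin n → ℝ)} {x : Fin n → ℝ} (hx : x ∈ M.dom) :
    M.metric (M.push y) (M.push z) x = y x ⬝ᵥ (M.fisher x).mulVec (z x) := by
  rw [M.dotProduct_fisher_mulVec hx]
  exact sldMetric_eq_left (M.point_mem x hx) (M.isSelfAdjoint_deriv hx _)
    (M.isSelfAdjoint_deriv hx _)

/-- The multiples of the identity in the dual observables drop out against the traceless Z. Once
these observables are constant, the point enters only through the covariant components Gy and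
through Z, so the expression can be differentiated by the product rule. -/
theorem metric_push_left {y : (Fin n → ℝ) → (Fin n → ℝ)} {Z : (Fin n → ℝ) → H →L[ℂ] H}
    {x : Fin n → ℝ} (hx : x ∈ M.dom) (hZ : Z x ∈ tangent H) :
    M.metric (M.push y) Z x =
      ∑ i, (M.fisher x).mulVec (y x) i * expect (Z x) (M.dualSLD (Pi.single i 1) x) := by
  rw [M.metric_eq_expect (Y := M.push y) hx ⟨M.isSelfAdjoint_deriv hx _, M.tr_deriv hx _⟩ hZ]
  change expect (M.tangentSLD x (y x)) (Z x) = _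
  rw [expect_comm, M.tangentSLD_eq hx, expect_sub_right, expect_smul_right, expect_one_right,
    hZ.2, M.dualSLD_eq_sum _ hx, expect_sum_right]
  simp only [expect_smul_right, Complex.zero_re, mul_zero, sub_zero]

/-- The observables `dualSLD u` do not depend on the point of the model. -/
def HasConstantDualSLD : Prop :=
  ∀ u, ∀ x ∈ M.dom, ∀ x' ∈ M.dom, M.dualSLD u x = M.dualSLD u x'

theorem contDiffOn_dualSLD (u : Fin n → ℝ) : ContDiffOn ℝ ∞ (M.dualSLD u) M.dom := by
  have h1 : ContDiffOn ℝ ∞ (fun x => M.tangentSLD x ((M.fisher x)⁻¹.mulVec u)) M.dom :=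
    M.contDiffOn_sld (M.contDiffOn_along M.contDiffOn_point
      (M.contDiffOn_inv_fisher_mulVec (y := fun _ => u) contDiffOn_const))
  have h2 : ContDiff ℝ ∞ (fun x : Fin n → ℝ => u ⬝ᵥ x) := by
    simp only [dotProduct]
    fun_prop
  exact (h2.contDiffOn.smul contDiffOn_const).add h1

theorem eq_of_forall_expect_eq {A B : H →L[ℂ] H} (hA : IsSelfAdjoint A) (hB : IsSelfAdjoint B)
    (h : ∀ Z, IsSelfAdjoint Z → expect A Z = expect B Z) : A = B := by
  refine sub_eq_zero.1 (expect_star_self_eq_zero ?_)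
  rw [(hA.sub hB).star_eq, expect_sub_left, h _ (hA.sub hB), sub_self]

end Model

/-! ### The connections and the constancy of the dual observables -/

namespace Model

variable {n : ℕ} (M : Model H n)

theorem along_eq_of_eqOn {F : Type*} [NormedAddCommGroup F] [NormedSpace ℝ F]
    {f g : (Fin n → ℝ) → F} (h : ∀ y ∈ M.dom, f y = g y) {x : Fin n → ℝ} (hx : x ∈ M.dom)
    (v : (Fin n → ℝ) → (Fin n → ℝ)) : along v f x = along v g x := by
  have h1 : f =ᶠ[𝓝 x] g := (M.eventually_mem_dom hx).mono h
  rw [along, along, h1.fderiv_eq]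

theorem isVectorField_const (v : Fin n → ℝ) : M.IsVectorField fun _ => v := contDiffOn_const

theorem metric_push_single {y : (Fin n → ℝ) → (Fin n → ℝ)} {x : Fin n → ℝ} (hx : x ∈ M.dom)
    (j : Fin n) : M.metric (M.push y) (M.push fun _ => Pi.single j 1) x =
      (M.fisher x).mulVec (y x) j := by
  rw [M.fisher_mulVec hx, expect_comm]
  exact sldMetric_eq_right (M.point_mem x hx) (M.isSelfAdjoint_deriv hx _)
    (M.isSelfAdjoint_deriv hx _)

/-- The vector field dual to `⟨u, ξ⟩` with respect to the metric. -/
def dualField (u x : Fin n → ℝ) : Fin n → ℝ := (M.fisher x)⁻¹.mulVec u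

theorem isVectorField_dualField (u : Fin n → ℝ) : M.IsVectorField (M.dualField u) :=
  M.contDiffOn_inv_fisher_mulVec (M.isVectorField_const u)

theorem metric_push_dualField (u : Fin n → ℝ) {Z : (Fin n → ℝ) → H →L[ℂ] H} {x : Fin n → ℝ}
    (hx : x ∈ M.dom) (hZ : Z x ∈ tangent H) :
    M.metric (M.push (M.dualField u)) Z x = expect (Z x) (M.dualSLD u x) := by
  rw [M.metric_eq_expect (Y := M.push (M.dualField u)) hx
    ⟨M.isSelfAdjoint_deriv hx _, M.tr_deriv hx _⟩ hZ,
    expect_comm, dualSLD, expect_add_right, expect_smul_right, expect_one_right, hZ.2]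
  simp [push, tangentSLD, dualField]

/-- For m-affine coordinates, the dual fields `dualField u` are parallel for the e-connection as
soon as their covariant derivative is tangent to the model. -/
theorem IsMAffine.eq_zero_of_isECovDeriv {M : Model H n} (h : M.IsMAffine) {u : Fin n → ℝ}
    {v w : (Fin n → ℝ) → (Fin n → ℝ)} (hv : M.IsVectorField v)
    (hw : M.IsECovDeriv v (M.push (M.dualField u)) (M.push w)) {x : Fin n → ℝ} (hx : x ∈ M.dom) :
    w x = 0 := by
  have h3 : ∀ j, (M.fisher x).mulVec (w x) j = 0 := by
    intro j
    -- Since g(D, ∂_j) = u_j is constant and ∂_j is m-parallel, duality leaves g(∇D, ∂_j) = 0 for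
    -- every j, that is, Gw = 0.
    have h4 := (h _ hv j).2 _ (M.push w) (M.isVectorField_dualField u) hw x hx
    rw [M.along_eq_of_eqOn (g := fun _ => u j) (fun a ha => ?_) hx] at h4
    · rw [M.metric_push_single hx, M.metric_push_push hx, Matrix.mulVec_zero,
        dotProduct_zero, add_zero] at h4
      simpa [along] using h4.symm
    · rw [M.metric_push_single ha, dualField, M.fisher_mulVec_inv_mulVec ha]
  rw [← M.inv_mulVec_fisher_mulVec hx (w x), funext h3]
  exact Matrix.mulVec_zero _

theorem tr_eq_re_of_isSelfAdjoint {A : H →L[ℂ] H} (hA : IsSelfAdjoint A) : tr A = (tr A).re := by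
  refine (Complex.conj_eq_iff_re.1 ?_).symm
  have := tr_star A
  rw [hA.star_eq] at this
  exact this.symm

/-- Subtracting (Tr A)ρ removes the trace. These test fields allow the dual observables to be probed
with arbitrary Hermitian operators, not only traceless ones. -/
theorem isFieldAlong_sub_smul_point {A : H →L[ℂ] H} (hA : IsSelfAdjoint A) :
    M.IsFieldAlong fun x => A - (tr A).re • M.point x := by
  have h : ContDiffOn ℝ ∞ (fun x => (tr A).re • M.point x) M.dom :=
    contDiffOn_const.fun_smul M.contDiffOn_point
  refine ⟨contDiffOn_const.sub h, fun x hx => ⟨?_, ?_⟩⟩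
  · exact hA.sub ((IsSelfAdjoint.all _).smul (M.point_mem x hx).1.isSelfAdjoint)
  · change trLin H _ = 0
    rw [map_sub, map_smul]
    change tr A - (tr A).re • tr (M.point x) = 0
    rw [(M.point_mem x hx).2.2, Complex.real_smul, mul_one, ← tr_eq_re_of_isSelfAdjoint hA,
      sub_self]

theorem along_sub_smul_point (A : H →L[ℂ] H) (c : ℝ) {x : Fin n → ℝ} (hx : x ∈ M.dom)
    (v : (Fin n → ℝ) → (Fin n → ℝ)) :
    along v (fun x => A - c • M.point x) x = (-c) • fderiv ℝ M.point x (v x) := by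
  have := ((M.differentiableAt_point hx).hasFDerivAt.fun_const_smul c).const_sub A
  rw [along, this.fderiv, neg_smul]
  rfl

theorem hasFDerivAt_dotProduct (u x : Fin n → ℝ) :
    HasFDerivAt (fun a : Fin n → ℝ => u ⬝ᵥ a)
      (∑ i, u i • (ContinuousLinearMap.proj i : (Fin n → ℝ) →L[ℝ] ℝ)) x := by
  have h := (∑ i, u i • (ContinuousLinearMap.proj i : (Fin n → ℝ) →L[ℝ] ℝ)).hasFDerivAt (x := x)
  refine h.congr_of_eventuallyEq (Eventually.of_forall fun a => ?_)
  simp [dotProduct]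

/-- For F = Z - (Tr Z)ρ one has g(D, F) = Re Tr(A_u Z) - (Tr Z)⟨u, x⟩. As D is e-parallel, the
derivative of this along v is g(D, ∇^(m)F) = -(Tr Z)⟨u, v⟩. The terms in Tr Z cancel. -/
theorem fderiv_expect_dualSLD_eq_zero (h1 : M.IsEAutoparallel) (h2 : M.IsMAffine)
    (u : Fin n → ℝ) {Z : H →L[ℂ] H} (hZ : IsSelfAdjoint Z) {x : Fin n → ℝ} (hx : x ∈ M.dom) :
    fderiv ℝ (fun a => expect (M.dualSLD u a) Z) x = 0 := by
  ext v
  have hf := fderiv_expect (M.differentiableAt_of_contDiffOn (M.contDiffOn_dualSLD u) hx) Z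
  obtain ⟨w, hw, hwe⟩ := h1 (fun _ => v) (M.dualField u) (M.isVectorField_const v)
    (M.isVectorField_dualField u)
  have hw0 := h2.eq_zero_of_isECovDeriv (M.isVectorField_const v) hwe hx
  obtain ⟨F, hFeq, hF⟩ : ∃ F, (F = fun a => Z - (tr Z).re • M.point a) ∧ M.IsFieldAlong F :=
    ⟨_, rfl, M.isFieldAlong_sub_smul_point hZ⟩
  have h6 := hwe.2 F hF x hx
  have h8 : ∀ a ∈ M.dom, M.metric (M.push (M.dualField u)) F a =
      expect (M.dualSLD u a) Z - (tr Z).re * (u ⬝ᵥ a) := by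
    intro a ha
    rw [M.metric_push_dualField u ha (hF.2 a ha), hFeq, expect_sub_left, expect_smul_left,
      M.expect_point_dualSLD u ha, expect_comm]
  have hd := (hasFDerivAt_dotProduct u x).const_mul (tr Z).re
  have h10 := HasFDerivAt.fun_sub hf hd
  rw [M.along_eq_of_eqOn h8 hx, M.metric_push_dualField u hx (hF.along_mem_tangent _ hx),
    M.metric_push_left hx (hF.2 x hx), hw0, hFeq, M.along_sub_smul_point _ _ hx, expect_smul_left,
    M.expect_deriv_dualSLD u v hx, along, h10.fderiv, ← hf.fderiv] at h6
  have h11 : (∑ i, u i • (ContinuousLinearMap.proj i : (Fin n → ℝ) →L[ℝ] ℝ)) v = u ⬝ᵥ v := by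
    simp [dotProduct]
  simp only [Matrix.mulVec_zero, Pi.zero_apply, zero_mul, Finset.sum_const_zero, zero_add,
    sub_apply, smul_apply, h11, smul_eq_mul, dotProduct_comm v u] at h6
  rw [zero_apply]
  linarith

/-- In an e-autoparallel model with m-affine coordinates, the observables `dualSLD u` are
constant. -/
theorem hasConstantDualSLD_of_isEAutoparallel (h1 : M.IsEAutoparallel) (h2 : M.IsMAffine) :
    M.HasConstantDualSLD := by
  intro u x hx x' hx'
  refine eq_of_forall_expect_eq (M.isSelfAdjoint_dualSLD u hx) (M.isSelfAdjoint_dualSLD u hx')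
    fun Z hZ => ?_
  exact M.isOpen_dom.is_const_of_fderiv_eq_zero (𝕜 := ℝ)
    (f := fun z => expect (M.dualSLD u z) Z) M.isPreconnected_dom
    (fun z hz => (fderiv_expect (M.differentiableAt_of_contDiffOn
      (M.contDiffOn_dualSLD u) hz) Z).differentiableAt.differentiableWithinAt)
    (fun z hz => M.fderiv_expect_dualSLD_eq_zero h1 h2 u hZ hz) hx hx'

theorem HasConstantDualSLD.metric_push_left {M : Model H n} (h : M.HasConstantDualSLD)
    {y : (Fin n → ℝ) → (Fin n → ℝ)} {Z : (Fin n → ℝ) → H →L[ℂ] H} {x a : Fin n → ℝ}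
    (hx : x ∈ M.dom) (ha : a ∈ M.dom) (hZ : Z a ∈ tangent H) :
    M.metric (M.push y) Z a =
      ∑ i, (M.fisher a).mulVec (y a) i * expect (Z a) (M.dualSLD (Pi.single i 1) x) := by
  rw [M.metric_push_left ha hZ]
  exact Finset.sum_congr rfl fun i _ => by rw [h _ a ha x hx]

/-- With constant A_i, the product rule for g(Y, Z) = ∑ (Gy)_i Re Tr(Z A_i) has two parts. The
derivative of Z accounts for g(Y, ∇^(m)Z), and that of Gy equals g(W, Z) for the tangent field W
with components w given by Gw = X(Gy). -/
theorem HasConstantDualSLD.isECovDeriv {M : Model H n} (h : M.HasConstantDualSLD)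
    {v y : (Fin n → ℝ) → (Fin n → ℝ)} (hv : M.IsVectorField v) (hy : M.IsVectorField y) :
    ∃ w, M.IsVectorField w ∧ M.IsECovDeriv v (M.push y) (M.push w) := by
  have hGy := M.contDiffOn_fisher_mulVec hy
  set Gy : (Fin n → ℝ) → (Fin n → ℝ) := fun a => (M.fisher a).mulVec (y a) with hGy_def
  have hw : M.IsVectorField fun a => (M.fisher a)⁻¹.mulVec (along v Gy a) :=
    M.contDiffOn_inv_fisher_mulVec (M.contDiffOn_along hGy hv)
  refine ⟨_, hw, hw.isFieldAlong_push, fun Z hZ x hx => ?_⟩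
  have hZd := M.differentiableAt_of_contDiffOn hZ.1 hx
  have hGd := hasFDerivAt_pi'.1 (M.differentiableAt_of_contDiffOn hGy hx).hasFDerivAt
  have h1 := HasFDerivAt.fun_sum (u := Finset.univ) fun i _ =>
    (hGd i).fun_mul (fderiv_expect hZd (M.dualSLD (Pi.single i 1) x))
  rw [M.along_eq_of_eqOn (fun a ha => h.metric_push_left hx ha (hZ.2 a ha)) hx,
    M.metric_push_left hx (hZ.2 x hx), M.metric_push_left hx (hZ.along_mem_tangent v hx),
    M.fisher_mulVec_inv_mulVec hx, along, h1.fderiv, ← Finset.sum_add_distrib,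
    _root_.sum_apply]
  refine Finset.sum_congr rfl fun i _ => ?_
  simp only [_root_.add_apply, _root_.smul_apply, smul_eq_mul, along,
    ContinuousLinearMap.comp_apply, ContinuousLinearMap.proj_apply, expectCLM_apply, hGy_def]
  ring

/-- By duality it suffices that the derivative of ∂_jρ is g-orthogonal to M. Its pairing with the
constant A_i is the derivative of Re Tr(∂_jρ A_i) = δ_ij, which is 0. -/
theorem HasConstantDualSLD.isMAffine {M : Model H n} (h : M.HasConstantDualSLD) :
    M.IsMAffine := by
  refine fun v hv j => ⟨M.isVectorField_const 0, fun y W hy hW x hx => ?_⟩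
  have hZ := (M.isVectorField_const (Pi.single j 1)).isFieldAlong_push
  have h0 := (M.isVectorField_const 0).isFieldAlong_push
  rw [hW.2 _ hZ x hx]
  congr 1
  rw [M.metric_push_left hx (hZ.along_mem_tangent v hx), M.metric_push_left hx (h0.2 x hx)]
  refine Finset.sum_congr rfl fun i _ => ?_
  congr 1
  have h1 := fderiv_expect (M.differentiableAt_of_contDiffOn hZ.1 hx)
    (M.dualSLD (Pi.single i 1) x)
  have h2 : (fun a => expect (M.push (fun _ => Pi.single j 1) a) (M.dualSLD (Pi.single i 1) x))
      =ᶠ[𝓝 x] fun _ => (Pi.single j 1 : Fin n → ℝ) ⬝ᵥ Pi.single i 1 := by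
    filter_upwards [M.eventually_mem_dom hx] with a ha
    rw [← h _ a ha x hx]
    exact M.expect_deriv_dualSLD _ _ ha
  have h3 := DFunLike.congr_fun
    ((h1.congr_of_eventuallyEq h2.symm).unique (hasFDerivAt_const _ x)) (v x)
  rw [push, map_zero, expect_zero_left]
  exact h3

/-- Condition (i): the model is e-autoparallel and the coordinates are m-affine if and only if
the efficient observables are constant along the model. -/
theorem isEAutoparallel_and_isMAffine_iff :
    (M.IsEAutoparallel ∧ M.IsMAffine) ↔ M.HasConstantDualSLD :=
  ⟨fun h => M.hasConstantDualSLD_of_isEAutoparallel h.1 h.2,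
    fun h => ⟨fun _ _ hv hy => h.isECovDeriv hv hy, h.isMAffine⟩⟩

end Model

/-! ### Functionals on the cone of positive operators -/

theorem isPositive_add_norm_smul_one {X : H →L[ℂ] H} (hX : IsSelfAdjoint X) :
    (X + ‖X‖ • (1 : H →L[ℂ] H)).IsPositive := by
  have h := hX.neg_algebraMap_norm_le_self
  rw [ContinuousLinearMap.le_def, sub_neg_eq_add, Algebra.algebraMap_eq_smul_one] at h
  exact h

theorem isPositive_norm_smul_one_sub {X : H →L[ℂ] H} (hX : IsSelfAdjoint X) :
    (‖X‖ • (1 : H →L[ℂ] H) - X).IsPositive := by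
  have h := hX.le_algebraMap_norm_self
  rw [ContinuousLinearMap.le_def, Algebra.algebraMap_eq_smul_one] at h
  exact h

theorem isPositive_real_smul {X : H →L[ℂ] H} (hX : X.IsPositive) {c : ℝ} (hc : 0 ≤ c) :
    (c • X).IsPositive := by
  have h : c • X = (c : ℂ) • X := by ext; simp
  rw [h]
  exact hX.smul_of_nonneg (by exact_mod_cast hc)

theorem isPositive_mul_mul {X B : H →L[ℂ] H} (hX : X.IsPositive) (hB : IsSelfAdjoint B) :
    (B * X * B).IsPositive := by
  have h := hX.conj_adjoint B
  rw [← ContinuousLinearMap.star_eq_adjoint, hB.star_eq] at h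
  exact h

/-- An additive and homogeneous function on the cone of positive operators is represented by a
Hermitian operator. -/
theorem exists_isSelfAdjoint_of_isPositive (e : (H →L[ℂ] H) → ℝ)
    (hadd : ∀ X Y : H →L[ℂ] H, X.IsPositive → Y.IsPositive → e (X + Y) = e X + e Y)
    (hsmul : ∀ (c : ℝ) (X : H →L[ℂ] H), 0 ≤ c → X.IsPositive → e (c • X) = c * e X) :
    ∃ T : H →L[ℂ] H, IsSelfAdjoint T ∧ ∀ X : H →L[ℂ] H, X.IsPositive → e X = expect X T := by
  -- A Hermitian X is shifted into the cone by ‖X‖ 1, and the effect of the shift is subtracted.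
  let φ : (H →L[ℂ] H) → ℝ := fun X => e (X + ‖X‖ • 1) - ‖X‖ * e 1
  have h1 : (1 : H →L[ℂ] H).IsPositive := ContinuousLinearMap.isPositive_one
  -- Every shift into the cone gives the same value. This is needed for additivity, because the
  -- shift ‖X‖ is not additive.
  have hφ : ∀ (X : H →L[ℂ] H) (c : ℝ), IsSelfAdjoint X → 0 ≤ c → (X + c • 1).IsPositive →
      e (X + c • 1) - c * e 1 = φ X := by
    intro X c hX hc hXc
    have h2 := hadd _ _ hXc (isPositive_real_smul h1 (norm_nonneg X))
    have h3 := hadd _ _ (isPositive_add_norm_smul_one hX) (isPositive_real_smul h1 hc)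
    rw [hsmul _ _ (norm_nonneg X) h1] at h2
    rw [hsmul _ _ hc h1, add_right_comm] at h3
    simp only [φ]
    linarith
  have hφadd : ∀ X Y : H →L[ℂ] H, IsSelfAdjoint X → IsSelfAdjoint Y →
      φ (X + Y) = φ X + φ Y := by
    intro X Y hX hY
    have h2 := isPositive_add_norm_smul_one hX
    have h3 := isPositive_add_norm_smul_one hY
    have h4 : X + Y + (‖X‖ + ‖Y‖) • (1 : H →L[ℂ] H) = (X + ‖X‖ • 1) + (Y + ‖Y‖ • 1) := by module
    rw [← hφ (X + Y) (‖X‖ + ‖Y‖) (hX.add hY) (by positivity) (by rw [h4]; exact h2.add h3), h4,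
      hadd _ _ h2 h3]
    simp only [φ]
    ring
  have hφnonneg : ∀ (c : ℝ) (X : H →L[ℂ] H), 0 ≤ c → IsSelfAdjoint X → φ (c • X) = c * φ X := by
    intro c X hc hX
    have h2 := isPositive_add_norm_smul_one hX
    have h4 : c • X + (c * ‖X‖) • (1 : H →L[ℂ] H) = c • (X + ‖X‖ • 1) := by module
    rw [← hφ (c • X) (c * ‖X‖) ((IsSelfAdjoint.all c).smul hX) (by positivity)
      (by rw [h4]; exact isPositive_real_smul h2 hc), h4, hsmul _ _ hc h2]
    simp only [φ]
    ring
  have hφsmul : ∀ (c : ℝ) (X : H →L[ℂ] H), IsSelfAdjoint X → φ (c • X) = c * φ X := by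
    intro c X hX
    rcases le_total 0 c with hc | hc
    · exact hφnonneg c X hc hX
    · have h2 := hφadd (c • X) ((-c) • X) ((IsSelfAdjoint.all c).smul hX)
        ((IsSelfAdjoint.all (-c)).smul hX)
      have h3 := hφnonneg 0 X le_rfl hX
      rw [← add_smul, add_neg_cancel, h3, hφnonneg (-c) X (by linarith) hX] at h2
      linarith
  have hsa : ∀ X : H →L[ℂ] H, IsSelfAdjoint ((2⁻¹ : ℝ) • (X + star X)) := fun X => by
    rw [IsSelfAdjoint, star_smul, star_add, star_star, star_trivial, add_comm]
  -- Composition with the Hermitian part makes φ real-linear on all operators.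
  obtain ⟨T, hT, hTφ⟩ := exists_isSelfAdjoint_expect_eq
    { toFun := fun X => φ ((2⁻¹ : ℝ) • (X + star X))
      map_add' := fun X Y => by
        rw [← hφadd _ _ (hsa X) (hsa Y), star_add]
        congr 1
        module
      map_smul' := fun c X => by
        rw [RingHom.id_apply, smul_eq_mul, ← hφsmul c _ (hsa X), star_smul, star_trivial]
        congr 1
        module }
  refine ⟨T, hT, fun X hX => ?_⟩
  rw [← hTφ X hX.isSelfAdjoint]
  change e X = φ ((2⁻¹ : ℝ) • (X + star X))
  rw [hX.isSelfAdjoint.star_eq, ← two_smul ℝ, smul_smul, inv_mul_cancel₀ two_ne_zero, one_smul,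
    ← hφ X 0 hX.isSelfAdjoint le_rfl (by simpa using hX)]
  simp

/-! ### Outcome distributions and the operator Jensen inequality -/

namespace POVM

variable {n : ℕ} (E : POVM H n)

theorem outcome_real_apply {ρ : H →L[ℂ] H} (hρ : ρ.IsPositive) {s : Set (Fin n → ℝ)}
    (hs : MeasurableSet s) : (E.outcome ρ).real s = expect ρ (E.toVectorMeasure s) := by
  rw [outcome, dif_pos hρ, SignedMeasure.toMeasureOfZeroLE_real_apply _ _ _ hs, univ_inter]
  rfl

instance isFiniteMeasure_outcome (ρ : H →L[ℂ] H) : IsFiniteMeasure (E.outcome ρ) := by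
  rw [outcome]
  split_ifs <;> infer_instance

theorem outcome_eq_of_real {ρ : H →L[ℂ] H} (hρ : ρ.IsPositive) (μ : Measure (Fin n → ℝ))
    [IsFiniteMeasure μ]
    (h : ∀ s, MeasurableSet s → μ.real s = expect ρ (E.toVectorMeasure s)) : E.outcome ρ = μ := by
  ext s hs
  rw [← measureReal_eq_measureReal_iff, E.outcome_real_apply hρ hs, h s hs]

/-- Positivity is essential: `outcome` has the default value 0 off the cone, so moments are linear
in the operator only on the cone. -/
theorem outcome_add {ρ σ : H →L[ℂ] H} (hρ : ρ.IsPositive) (hσ : σ.IsPositive) :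
    E.outcome (ρ + σ) = E.outcome ρ + E.outcome σ := by
  refine E.outcome_eq_of_real (hρ.add hσ) _ fun s hs => ?_
  rw [measureReal_add_apply, E.outcome_real_apply hρ hs, E.outcome_real_apply hσ hs,
    expect_add_left]

theorem outcome_smul {ρ : H →L[ℂ] H} (hρ : ρ.IsPositive) {c : ℝ} (hc : 0 ≤ c) :
    E.outcome (c • ρ) = c.toNNReal • E.outcome ρ := by
  refine E.outcome_eq_of_real (isPositive_real_smul hρ hc) _ fun s hs => ?_
  rw [measureReal_nnreal_smul_apply, E.outcome_real_apply hρ hs, Real.coe_toNNReal _ hc,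
    expect_smul_left]

/-- The first moment of `f` under a POVM is a Hermitian operator. -/
theorem exists_integral_outcome_eq {f : (Fin n → ℝ) → ℝ}
    (hf : ∀ X : H →L[ℂ] H, X.IsPositive → Integrable f (E.outcome X)) :
    ∃ T : H →L[ℂ] H, IsSelfAdjoint T ∧
      ∀ X : H →L[ℂ] H, X.IsPositive → ∫ y, f y ∂(E.outcome X) = expect X T := by
  refine exists_isSelfAdjoint_of_isPositive (fun X => ∫ y, f y ∂(E.outcome X)) ?_ ?_
  · intro X Y hX hY
    simp only [E.outcome_add hX hY]
    exact integral_add_measure (hf X hX) (hf Y hY)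
  · intro c X hc hX
    simp only [E.outcome_smul hX hc]
    rw [integral_smul_nnreal_measure, NNReal.smul_def, Real.coe_toNNReal _ hc, smul_eq_mul]

/-- The cross term ρB + Bρ need not be positive. It is written by polarization through (1 + B)ρ(1 +
B), ρ and BρB, all of which have an outcome distribution when ρ is positive and B is Hermitian. -/
theorem sub_mul_mul_sub (ρ B : H →L[ℂ] H) (r : ℝ) :
    (r • 1 - B) * ρ * (r • 1 - B) =
      (r ^ 2) • ρ - r • ((1 + B) * ρ * (1 + B) - ρ - B * ρ * B) + B * ρ * B := by
  simp only [sub_mul, mul_sub, add_mul, mul_add, smul_mul_assoc, mul_smul_comm, one_mul, mul_one]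
  module

/-- This is the expansion of the sum over the values r of g of the nonnegative numbers Re Tr((r -
B)ρ(r - B) Π(g = r)), the operator form of E(g - B)² ≥ 0. -/
theorem integral_simpleFunc_sq_nonneg {ρ B : H →L[ℂ] H} (hρ : ρ.IsPositive)
    (hB : IsSelfAdjoint B) (g : SimpleFunc (Fin n → ℝ) ℝ) :
    0 ≤ ∫ y, g y ^ 2 ∂(E.outcome ρ) - (∫ y, g y ∂(E.outcome ((1 + B) * ρ * (1 + B)))
        - ∫ y, g y ∂(E.outcome ρ) - ∫ y, g y ∂(E.outcome (B * ρ * B)))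
      + expect (B * ρ * B) 1 := by
  have hBB := isPositive_mul_mul hρ hB
  have hBB' := isPositive_mul_mul hρ ((IsSelfAdjoint.one (H →L[ℂ] H)).add hB)
  have hint : ∀ X : H →L[ℂ] H, ∫ y, g y ∂(E.outcome X) =
      ∑ r ∈ g.range, (E.outcome X).real (g ⁻¹' {r}) * r := by
    intro X
    rw [← SimpleFunc.integral_eq_integral g (SimpleFunc.integrable_of_isFiniteMeasure g),
      SimpleFunc.integral_def]
    rfl
  have hint2 : ∫ y, g y ^ 2 ∂(E.outcome ρ) =
      ∑ r ∈ g.range, (E.outcome ρ).real (g ⁻¹' {r}) * r ^ 2 := by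
    have h := SimpleFunc.map_integral (μ := E.outcome ρ) g (fun r => r ^ 2)
      (SimpleFunc.integrable_of_isFiniteMeasure g) (by norm_num)
    rw [SimpleFunc.integral_eq_integral _ (SimpleFunc.integrable_of_isFiniteMeasure _)] at h
    exact h
  have huniv : expect (B * ρ * B) 1 =
      ∑ r ∈ g.range, (E.outcome (B * ρ * B)).real (g ⁻¹' {r}) := by
    rw [← E.univ_eq_one, ← E.outcome_real_apply hBB MeasurableSet.univ, measureReal_def,
      ← g.sum_range_measure_preimage_singleton, ENNReal.toReal_sum fun _ _ => measure_ne_top _ _]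
    rfl
  rw [hint, hint, hint, hint2, huniv, ← Finset.sum_sub_distrib, ← Finset.sum_sub_distrib,
    ← Finset.sum_sub_distrib, ← Finset.sum_add_distrib]
  refine Finset.sum_nonneg fun r _ => ?_
  have hs : MeasurableSet (g ⁻¹' {r}) := g.measurableSet_fiber r
  rw [E.outcome_real_apply hρ hs, E.outcome_real_apply hBB hs, E.outcome_real_apply hBB' hs]
  have h := expect_nonneg (isPositive_mul_mul hρ
    (((IsSelfAdjoint.all r).smul (IsSelfAdjoint.one (H →L[ℂ] H))).sub hB))
    (E.isPositive (g ⁻¹' {r}))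
  rw [sub_mul_mul_sub, expect_add_left, expect_sub_left, expect_smul_left, expect_smul_left,
    expect_sub_left, expect_sub_left] at h
  linarith

/-- The operator Jensen inequality: the second moment of `f` dominates the expectation of the square
of its first moment. -/
theorem expect_mul_self_le_integral_sq {f : (Fin n → ℝ) → ℝ} (hfm : Measurable f)
    (hf : ∀ X : H →L[ℂ] H, X.IsPositive → MemLp f 2 (E.outcome X)) {T : H →L[ℂ] H}
    (hT : IsSelfAdjoint T)
    (hTf : ∀ X : H →L[ℂ] H, X.IsPositive → ∫ y, f y ∂(E.outcome X) = expect X T)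
    {ρ : H →L[ℂ] H} (hρ : ρ.IsPositive) :
    expect ρ (T * T) ≤ ∫ y, f y ^ 2 ∂(E.outcome ρ) := by
  have hBB := isPositive_mul_mul hρ hT
  have hBB' := isPositive_mul_mul hρ ((IsSelfAdjoint.one (H →L[ℂ] H)).add hT)
  let g : ℕ → SimpleFunc (Fin n → ℝ) ℝ := fun k =>
    SimpleFunc.approxOn f hfm univ 0 (mem_univ 0) k
  have hg : ∀ y, Tendsto (fun k => g k y) atTop (𝓝 (f y)) := fun y =>
    SimpleFunc.tendsto_approxOn hfm (mem_univ 0) (by simp)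
  have hgle : ∀ y k, ‖g k y‖ ≤ ‖f y‖ + ‖f y‖ := fun y k =>
    SimpleFunc.norm_approxOn_zero_le hfm (mem_univ 0) y k
  have h1 : ∀ X : H →L[ℂ] H, X.IsPositive →
      Tendsto (fun k => ∫ y, g k y ∂(E.outcome X)) atTop (𝓝 (∫ y, f y ∂(E.outcome X))) := by
    intro X hX
    have hi := ((hf X hX).integrable one_le_two).norm
    exact tendsto_integral_of_dominated_convergence (fun y => ‖f y‖ + ‖f y‖)
      (fun k => (g k).aestronglyMeasurable) (hi.add hi)
      (fun k => Eventually.of_forall fun y => hgle y k) (Eventually.of_forall hg)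
  have h2 : Tendsto (fun k => ∫ y, g k y ^ 2 ∂(E.outcome ρ)) atTop
      (𝓝 (∫ y, f y ^ 2 ∂(E.outcome ρ))) := by
    refine tendsto_integral_of_dominated_convergence (fun y => 4 * f y ^ 2)
      (fun k => ((g k).measurable.pow_const 2).aestronglyMeasurable)
      ((hf ρ hρ).integrable_sq.const_mul 4)
      (fun k => Eventually.of_forall fun y => ?_) (Eventually.of_forall fun y => (hg y).pow 2)
    have h3 := pow_le_pow_left₀ (norm_nonneg _) (hgle y k) 2
    rw [norm_pow]
    refine h3.trans_eq ?_
    rw [← two_mul, mul_pow, Real.norm_eq_abs, sq_abs]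
    norm_num
  -- In the limit with B = T, the cross term becomes Re Tr((ρT + Tρ)T) = 2 Re Tr(ρT²), and the last
  -- term is Re Tr(ρT²).
  have h4 := ge_of_tendsto' ((h2.sub (((h1 _ hBB').sub (h1 _ hρ)).sub (h1 _ hBB))).add_const
    (expect (T * ρ * T) 1)) fun k => E.integral_simpleFunc_sq_nonneg hρ hT (g k)
  rw [hTf _ hBB', hTf _ hρ, hTf _ hBB, ← expect_sub_left, ← expect_sub_left] at h4
  have h5 : (1 + T) * ρ * (1 + T) - ρ - T * ρ * T = ρ * T + T * ρ := by noncomm_ring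
  have h6 : expect (T * ρ * T) 1 = expect ρ (T * T) := by
    simp only [expect, mul_one]
    rw [mul_assoc, tr_mul_comm, mul_assoc]
  have h7 : expect (ρ * T) T = expect ρ (T * T) := by simp only [expect, mul_assoc]
  have h8 : expect (T * ρ) T = expect ρ (T * T) := by
    rw [← h6]
    simp only [expect, mul_one]
  rw [h5, expect_add_left, h6, h7, h8] at h4
  linarith

end POVM

/-! ### Estimators with finitely many values -/

namespace POVM

variable {n : ℕ} {ι : Type*} [Fintype ι]

/-- The POVM with finitely many outcomes `y i` and effects `P i`. -/
def ofFintype (P : ι → H →L[ℂ] H) (y : ι → Fin n → ℝ) (hP : ∀ i, (P i).IsPositive)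
    (hsum : ∑ i, P i = 1) : POVM H n where
  toVectorMeasure := ∑ i, VectorMeasure.dirac (y i) (P i)
  isPositive s := by
    rw [FunLike.coe_sum, Finset.sum_apply]
    refine ContinuousLinearMap.isPositive_sum _ fun i _ => ?_
    by_cases hs : MeasurableSet s
    · by_cases hi : y i ∈ s
      · rw [VectorMeasure.dirac_apply_of_mem hs hi]
        exact hP i
      · rw [VectorMeasure.dirac_apply_of_notMem hi]
        exact ContinuousLinearMap.isPositive_zero
    · rw [VectorMeasure.not_measurable _ hs]
      exact ContinuousLinearMap.isPositive_zero
  univ_eq_one := by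
    rw [FunLike.coe_sum, Finset.sum_apply, ← hsum]
    exact Finset.sum_congr rfl fun i _ =>
      VectorMeasure.dirac_apply_of_mem MeasurableSet.univ (mem_univ _)

variable {P : ι → H →L[ℂ] H} {y : ι → Fin n → ℝ} (hP : ∀ i, (P i).IsPositive)
  (hsum : ∑ i, P i = 1)

theorem outcome_ofFintype {ρ : H →L[ℂ] H} (hρ : ρ.IsPositive) :
    (ofFintype P y hP hsum).outcome ρ =
      ∑ i, ENNReal.ofReal (expect ρ (P i)) • Measure.dirac (y i) := by
  have hfin : IsFiniteMeasure (∑ i, ENNReal.ofReal (expect ρ (P i)) • Measure.dirac (y i)) :=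
    ⟨by simp [Measure.finsetSum_apply, ENNReal.sum_lt_top]⟩
  refine outcome_eq_of_real _ hρ _ fun s hs => ?_
  rw [measureReal_def, Measure.finsetSum_apply, ENNReal.toReal_sum (by
    intro i _
    rw [Measure.smul_apply, smul_eq_mul]
    exact ENNReal.mul_ne_top ENNReal.ofReal_ne_top (measure_ne_top _ _))]
  change _ = expect ρ ((∑ i, VectorMeasure.dirac (y i) (P i)) s)
  rw [FunLike.coe_sum, Finset.sum_apply, expect_sum_right]
  refine Finset.sum_congr rfl fun i _ => ?_
  rw [Measure.smul_apply, smul_eq_mul, ENNReal.toReal_mul,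
    ENNReal.toReal_ofReal (expect_nonneg hρ (hP i))]
  by_cases hi : y i ∈ s
  · rw [VectorMeasure.dirac_apply_of_mem hs hi, Measure.dirac_apply_of_mem hi]
    simp
  · rw [VectorMeasure.dirac_apply_of_notMem hi, Measure.dirac_apply' _ hs, expect_zero_right]
    simp [hi]

theorem integrable_outcome_ofFintype {ρ : H →L[ℂ] H} (hρ : ρ.IsPositive)
    (f : (Fin n → ℝ) → ℝ) : Integrable f ((ofFintype P y hP hsum).outcome ρ) := by
  rw [outcome_ofFintype hP hsum hρ, integrable_finsetSum_measure]
  exact fun i _ => (integrable_dirac (by simp)).smul_measure ENNReal.ofReal_ne_top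

theorem integral_outcome_ofFintype {ρ : H →L[ℂ] H} (hρ : ρ.IsPositive)
    (f : (Fin n → ℝ) → ℝ) :
    ∫ z, f z ∂((ofFintype P y hP hsum).outcome ρ) = ∑ i, expect ρ (P i) * f (y i) := by
  rw [outcome_ofFintype hP hsum hρ, integral_finsetSum_measure
    fun i _ => (integrable_dirac (by simp)).smul_measure ENNReal.ofReal_ne_top]
  refine Finset.sum_congr rfl fun i _ => ?_
  rw [integral_smul_measure, integral_dirac, ENNReal.toReal_ofReal (expect_nonneg hρ (hP i)),
    smul_eq_mul]

end POVM

namespace Estimator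

variable {n : ℕ} {ι : Type*} [Fintype ι]

/-- The estimator with finitely many values `y i` and effects `P i`. -/
def ofFintype (P : ι → H →L[ℂ] H) (y : ι → Fin n → ℝ) (hP : ∀ i, (P i).IsPositive)
    (hsum : ∑ i, P i = 1) : Estimator H n where
  toPOVM := POVM.ofFintype P y hP hsum
  memLp_two _ hρ _ := (memLp_two_iff_integrable_sq (measurable_pi_apply _).aestronglyMeasurable).2
    (POVM.integrable_outcome_ofFintype hP hsum hρ.1 _)

end Estimator

/-- The spectral decomposition of a Hermitian operator. -/
theorem exists_spectral_decomposition {C : H →L[ℂ] H} (hC : IsSelfAdjoint C) :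
    ∃ (P : Fin (Module.finrank ℂ H) → H →L[ℂ] H) (a : Fin (Module.finrank ℂ H) → ℝ),
      (∀ m, (P m).IsPositive) ∧ ∑ m, P m = 1 ∧ ∑ m, a m • P m = C ∧
        ∑ m, (a m) ^ 2 • P m = C * C := by
  have hs := hC.isSymmetric
  let b := hs.eigenvectorBasis rfl
  let P : Fin (Module.finrank ℂ H) → H →L[ℂ] H := fun m => InnerProductSpace.rankOne ℂ (b m) (b m)
  have hev : ∀ m, C * P m = (hs.eigenvalues rfl m) • P m := fun m => by
    ext v
    have : C (b m) = (hs.eigenvalues rfl m : ℂ) • b m := hs.apply_eigenvectorBasis rfl m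
    change C (inner ℂ (b m) v • b m) = (hs.eigenvalues rfl m) • (inner ℂ (b m) v • b m)
    rw [map_smul, this, smul_comm]
    rfl
  have h1 : ∑ m, P m = 1 := b.sum_rankOne_eq_id
  have h2 : ∑ m, hs.eigenvalues rfl m • P m = C := by
    simp only [← hev]
    rw [← Finset.mul_sum, h1, mul_one]
  refine ⟨P, hs.eigenvalues rfl, fun m => InnerProductSpace.isPositive_rankOne_self _, h1, h2, ?_⟩
  refine Eq.trans ?_ (congrArg (C * ·) h2)
  simp only [Finset.mul_sum]
  refine Finset.sum_congr rfl fun m _ => ?_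
  rw [mul_smul_comm, hev, smul_smul, sq]

/-- With probability `p k` the observable `C k` is measured, and its value `a` is reported as the
estimate `(a / p k) • d k`. -/
theorem exists_estimator_mixture {n : ℕ} {κ : Type*} [Fintype κ] (C : κ → H →L[ℂ] H)
    (hC : ∀ k, IsSelfAdjoint (C k)) (p : κ → ℝ) (hp : ∀ k, 0 < p k) (hp1 : ∑ k, p k = 1)
    (d : κ → Fin n → ℝ) :
    ∃ E : Estimator H n, ∀ ρ : H →L[ℂ] H, ρ.IsPositive →
      (∀ i, E.expectation ρ i = ∑ k, d k i * expect ρ (C k)) ∧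
      ∀ (u : Fin n → ℝ) (c : ℝ), ∫ y, (u ⬝ᵥ y - c) ^ 2 ∂(E.outcome ρ) =
        ∑ k, ((u ⬝ᵥ d k) ^ 2 / p k * expect ρ (C k * C k) -
          2 * c * (u ⬝ᵥ d k) * expect ρ (C k) + p k * c ^ 2 * expect ρ 1) := by
  choose P a hP hP1 haC haC2 using fun k => exists_spectral_decomposition (hC k)
  let y : κ × Fin (Module.finrank ℂ H) → Fin n → ℝ := fun q => (a q.1 q.2 / p q.1) • d q.1
  have hpos : ∀ q : κ × Fin (Module.finrank ℂ H), (p q.1 • P q.1 q.2).IsPositive :=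
    fun q => isPositive_real_smul (hP _ _) (hp _).le
  have hsum : ∑ q : κ × Fin (Module.finrank ℂ H), p q.1 • P q.1 q.2 = 1 := by
    rw [Fintype.sum_prod_type]
    simp only [← Finset.smul_sum, hP1]
    rw [← Finset.sum_smul, hp1, one_smul]
  let E : Estimator H n := Estimator.ofFintype _ y hpos hsum
  refine ⟨E, fun ρ hρ => ?_⟩
  have hint : ∀ f : (Fin n → ℝ) → ℝ, ∫ z, f z ∂(E.outcome ρ) =
      ∑ k, ∑ m, p k * expect ρ (P k m) * f ((a k m / p k) • d k) := by
    intro f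
    refine (POVM.integral_outcome_ofFintype hpos hsum hρ f).trans ?_
    rw [Fintype.sum_prod_type]
    simp only [expect_smul_right, y]
  refine ⟨fun i => ?_, fun u c => ?_⟩
  · rw [Estimator.expectation, hint]
    refine Finset.sum_congr rfl fun k _ => ?_
    rw [← haC k, expect_sum_right, Finset.mul_sum]
    refine Finset.sum_congr rfl fun m _ => ?_
    have := (hp k).ne'
    rw [expect_smul_right, Pi.smul_apply, smul_eq_mul]
    field_simp
  · rw [hint]
    refine Finset.sum_congr rfl fun k _ => ?_
    conv_rhs => rw [← haC2 k]
    conv_rhs => enter [1, 2, 2]; rw [← haC k]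
    rw [← hP1 k, expect_sum_right, expect_sum_right, expect_sum_right, Finset.mul_sum,
      Finset.mul_sum, Finset.mul_sum, ← Finset.sum_sub_distrib, ← Finset.sum_add_distrib]
    refine Finset.sum_congr rfl fun m _ => ?_
    have := (hp k).ne'
    rw [expect_smul_right, expect_smul_right, dotProduct_smul, smul_eq_mul]
    field_simp
    ring

/-- Hermitian operators `A i` are the expectations of estimators for which the second moments of
`⟨u, ξ⟩` are arbitrarily close to those of the observable `∑ u_i A_i`. -/
theorem exists_estimator_of_observables {n : ℕ} (A : Fin n → H →L[ℂ] H)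
    (hA : ∀ i, IsSelfAdjoint (A i)) (u : Fin n → ℝ) {δ : ℝ} (hδ : 0 < δ) :
    ∃ E : Estimator H n, ∀ ρ ∈ states H,
      (∀ i, E.expectation ρ i = expect ρ (A i)) ∧
      ∀ c : ℝ, ∫ y, (u ⬝ᵥ y - c) ^ 2 ∂(E.outcome ρ) =
        (1 + n * δ) * expect ρ ((∑ i, u i • A i) * (∑ i, u i • A i)) -
          2 * c * expect ρ (∑ i, u i • A i) + c ^ 2 := by
  -- The vector c splits off the direction seen by u. With S = ∑ u_k A_k and u·c = 1, the vector of
  -- the A_i is c S + ∑ (e_k - u_k c)(A_k - c_k S), where every e_k - u_k c is orthogonal to u. For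
  -- u = 0 the choice c = 0 works as well.
  obtain ⟨c, hc⟩ : ∃ c : Fin n → ℝ, u = 0 ∧ c = 0 ∨ u ⬝ᵥ c = 1 := by
    by_cases hu : u = 0
    · exact ⟨0, Or.inl ⟨hu, rfl⟩⟩
    · refine ⟨(u ⬝ᵥ u)⁻¹ • u, Or.inr ?_⟩
      rw [dotProduct_smul, smul_eq_mul, inv_mul_cancel₀]
      rwa [Ne, dotProduct_self_eq_zero]
  set S : H →L[ℂ] H := ∑ i, u i • A i with hS
  have hSsa : IsSelfAdjoint S := isSelfAdjoint_sum_smul hA u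
  have hcS : (u ⬝ᵥ c) • S = S := by
    rcases hc with ⟨h, -⟩ | h
    · simp [hS, h]
    · rw [h, one_smul]
  have hcc : ∀ i, c i * (u ⬝ᵥ c) = c i := fun i => by
    rcases hc with ⟨-, h⟩ | h <;> simp [h]
  have huc : ∀ i, u i * (u ⬝ᵥ c) = u i := fun i => by
    rcases hc with ⟨h, -⟩ | h <;> simp [h]
  have hN : 0 < 1 + n * δ := by positivity
  -- The outcome `none` measures S and has probability 1/(1 + nδ); the n others share the rest
  -- equally and report 0 for ⟨u, ξ⟩. Hence the second moment of S is only multiplied by 1 + nδ.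
  obtain ⟨E, hE⟩ := exists_estimator_mixture (κ := Option (Fin n))
    (fun k => k.elim S fun k => A k - c k • S)
    (fun k => by
      cases k with
      | none => exact hSsa
      | some k => exact (hA k).sub ((IsSelfAdjoint.all (c k)).smul hSsa))
    (fun k => k.elim (1 / (1 + n * δ)) fun _ => δ / (1 + n * δ))
    (fun k => by cases k <;> simp only [Option.elim] <;> positivity)
    (by
      rw [Fintype.sum_option]
      simp only [Option.elim, Finset.sum_const, Finset.card_univ, Fintype.card_fin, nsmul_eq_mul]
      field_simp)
    (fun k => k.elim c fun k => Pi.single k 1 - u k • c)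
  refine ⟨E, fun ρ hρ => ⟨fun i => ?_, fun t => ?_⟩⟩
  · rw [(hE ρ hρ.1).1, Fintype.sum_option]
    simp only [Option.elim]
    have h1 : expect ρ S = ∑ k, u k * expect ρ (A k) := by
      rw [hS, expect_sum_right]
      simp only [expect_smul_right]
    have h2 : ∀ k : Fin n, (Pi.single k 1 - u k • c : Fin n → ℝ) i * expect ρ (A k - c k • S) =
        (Pi.single k 1 : Fin n → ℝ) i * (expect ρ (A k) - c k * expect ρ S) -
          c i * (u k * expect ρ (A k)) + c i * (u k * c k) * expect ρ S := by
      intro k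
      rw [expect_sub_right, expect_smul_right, Pi.sub_apply, Pi.smul_apply, smul_eq_mul]
      ring
    have h3 : ∑ k, u k * c k = u ⬝ᵥ c := rfl
    rw [Finset.sum_congr rfl fun k _ => h2 k, Finset.sum_add_distrib, Finset.sum_sub_distrib,
      ← Finset.mul_sum, ← h1, ← Finset.sum_mul, ← Finset.mul_sum, h3, hcc]
    simp [Pi.single_apply]
  · rw [(hE ρ hρ.1).2, Fintype.sum_option]
    have h0 : ∀ k : Fin n, u ⬝ᵥ (Pi.single k 1 - u k • c) = 0 := fun k => by
      rw [dotProduct_sub, dotProduct_smul, dotProduct_single, smul_eq_mul, huc, mul_one, sub_self]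
    have h4 : expect ρ (S * S) = (u ⬝ᵥ c) ^ 2 * expect ρ (S * S) := by
      conv_lhs => rw [← hcS]
      rw [smul_mul_smul_comm, expect_smul_right, sq]
    have h5 : expect ρ S = (u ⬝ᵥ c) * expect ρ S := by
      conv_lhs => rw [← hcS, expect_smul_right]
    have h6 : expect ρ 1 = 1 := Model.expect_one_of_mem_states hρ
    simp only [Option.elim, h0, h6, ne_eq, OfNat.ofNat_ne_zero, not_false_eq_true, zero_pow,
      zero_div, zero_mul, mul_zero, sub_zero, zero_add, Finset.sum_const, Finset.card_univ,
      Fintype.card_fin, nsmul_eq_mul]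
    conv_rhs => rw [h4, h5]
    field_simp
    ring

/-! First moments of estimators -/

/-- The maximally mixed state serves as a reference, since every positive operator is dominated by a
multiple of it. The existence of an operator of trace 1 excludes dimension 0. -/
theorem smul_one_mem_states (h : (states H).Nonempty) :
    0 < (Module.finrank ℂ H : ℝ) ∧ ((Module.finrank ℂ H : ℝ)⁻¹ • (1 : H →L[ℂ] H)) ∈ states H := by
  obtain ⟨ρ, hρ⟩ := h
  have hd : 0 < Module.finrank ℂ H := by
    rw [Module.finrank_pos_iff]
    by_contra hH
    rw [not_nontrivial_iff_subsingleton] at hH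
    have h0 : ρ = 0 := by
      ext v
      exact Subsingleton.elim _ _
    have h1 := hρ.2.2
    rw [h0] at h1
    simp [tr] at h1
  have hd' : 0 < (Module.finrank ℂ H : ℝ) := by exact_mod_cast hd
  refine ⟨hd', isPositive_real_smul ContinuousLinearMap.isPositive_one (by positivity),
    fun v hv => ?_, ?_⟩
  · have h1 : ((Module.finrank ℂ H : ℝ)⁻¹ • (1 : H →L[ℂ] H)) v =
        (((Module.finrank ℂ H : ℝ)⁻¹ : ℝ) : ℂ) • v := by
      rw [Complex.coe_smul]
      rfl
    have hv' : 0 < ‖v‖ := norm_pos_iff.2 hv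
    rw [h1, inner_smul_right, Complex.re_ofReal_mul, inner_self_eq_norm_sq_to_K]
    have h2 : (((‖v‖ : ℝ) : ℂ) ^ 2).re = ‖v‖ ^ 2 := by norm_cast
    refine mul_pos (by positivity) (h2.symm ▸ ?_ : 0 < (((‖v‖ : ℝ) : ℂ) ^ 2).re)
    positivity
  · have h1 : tr ((Module.finrank ℂ H : ℝ)⁻¹ • (1 : H →L[ℂ] H)) =
        (Module.finrank ℂ H : ℝ)⁻¹ • tr (1 : H →L[ℂ] H) := (trLin H).map_smul _ _
    have h2 : tr (1 : H →L[ℂ] H) = Module.finrank ℂ H := LinearMap.trace_one ℂ H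
    rw [h1, h2, Complex.real_smul, Complex.ofReal_inv, Complex.ofReal_natCast,
      inv_mul_cancel₀ (by exact_mod_cast hd.ne')]

namespace Estimator

variable {n : ℕ} (E : Estimator H n)

/-- From X ≤ ‖X‖ 1 the outcome measure of X is dominated by a multiple of that of the maximally
mixed state. The Jensen inequality needs moments for operators such as (1 + T)ρ(1 + T), which need
not be states. -/
theorem memLp_outcome (h : (states H).Nonempty) {X : H →L[ℂ] H} (hX : X.IsPositive) (i : Fin n) :
    MemLp (fun y : Fin n → ℝ => y i) 2 (E.outcome X) := by
  obtain ⟨hd, hτ⟩ := smul_one_mem_states h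
  have h1 := (E.memLp_two _ hτ i).smul_measure (c := (‖X‖ * Module.finrank ℂ H).toNNReal)
    ENNReal.coe_ne_top
  have h2 := E.outcome_smul hτ.1 (c := ‖X‖ * Module.finrank ℂ H) (by positivity)
  have h3 : (‖X‖ * Module.finrank ℂ H) • ((Module.finrank ℂ H : ℝ)⁻¹ • (1 : H →L[ℂ] H)) =
      X + (‖X‖ • 1 - X) := by
    rw [smul_smul, mul_assoc, mul_inv_cancel₀ hd.ne', mul_one, add_sub_cancel]
  rw [h3, E.outcome_add hX (isPositive_norm_smul_one_sub hX.isSelfAdjoint)] at h2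
  refine h1.mono_measure (le_of_le_of_eq ?_ h2)
  exact Measure.le_add_right le_rfl

theorem exists_moments (h : (states H).Nonempty) :
    ∃ T : Fin n → H →L[ℂ] H, (∀ i, IsSelfAdjoint (T i)) ∧
      ∀ i, ∀ X : H →L[ℂ] H, X.IsPositive → E.expectation X i = expect X (T i) := by
  choose T hT hTX using fun i : Fin n => E.exists_integral_outcome_eq
    (f := fun y => y i) fun X hX => (E.memLp_outcome h hX i).integrable one_le_two
  exact ⟨T, hT, hTX⟩

/-- The mean squared error of an estimator of `⟨u, ξ⟩` is at least that of its first moment. -/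
theorem symInner_le_integral (h : (states H).Nonempty) {T : Fin n → H →L[ℂ] H}
    (hT : ∀ i, IsSelfAdjoint (T i))
    (hTX : ∀ i, ∀ X : H →L[ℂ] H, X.IsPositive → E.expectation X i = expect X (T i))
    (u : Fin n → ℝ) (c : ℝ) {ρ : H →L[ℂ] H} (hρ : ρ.IsPositive) :
    symInner ρ (∑ i, u i • T i - c • 1) (∑ i, u i • T i - c • 1) ≤
      ∫ y, (u ⬝ᵥ y - c) ^ 2 ∂(E.outcome ρ) := by
  have hi : ∀ X : H →L[ℂ] H, X.IsPositive →
      MemLp (fun y : Fin n → ℝ => u ⬝ᵥ y) 2 (E.outcome X) := by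
    intro X hX
    simp only [dotProduct]
    exact memLp_finsetSum _ fun i _ => (E.memLp_outcome h hX i).const_mul (u i)
  rw [symInner_eq_expect_mul]
  refine E.expect_mul_self_le_integral_sq (f := fun y => u ⬝ᵥ y - c) ?_ (fun X hX => (hi X hX).sub (memLp_const c)) ?_ ?_ hρ
  · simp only [dotProduct]
    fun_prop
  · exact (isSelfAdjoint_sum_smul hT u).sub
      ((IsSelfAdjoint.all c).smul (IsSelfAdjoint.one _))
  · intro X hX
    rw [integral_sub ((hi X hX).integrable one_le_two) (integrable_const c), integral_const,
      E.outcome_real_apply hX MeasurableSet.univ, E.univ_eq_one, expect_sub_right,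
      expect_smul_right, expect_sum_right, smul_eq_mul, mul_comm c]
    congr 1
    simp only [dotProduct]
    rw [integral_finsetSum _ fun i _ =>
      ((E.memLp_outcome h hX i).integrable one_le_two).const_mul (u i)]
    refine Finset.sum_congr rfl fun i _ => ?_
    rw [integral_const_mul, expect_smul_right, ← hTX i X hX]
    rfl

end Estimator

/-! ### The Cramér-Rao bound and efficient filtrations -/

namespace Model

variable {n : ℕ} (M : Model H n)

/-- Local unbiasedness in terms of the first moments of the estimator. -/
theorem isLocallyUnbiased_iff {E : Estimator H n} {T : Fin n → H →L[ℂ] H}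
    (hT : ∀ i, ∀ ρ ∈ states H, E.expectation ρ i = expect ρ (T i)) {x : Fin n → ℝ}
    (hx : x ∈ M.dom) :
    M.IsLocallyUnbiased E x ↔ (∀ i, expect (M.point x) (T i) = x i) ∧
      ∀ i j, expect (fderiv ℝ M.point x (Pi.single j 1)) (T i) = if i = j then 1 else 0 := by
  have h : ∀ i j, partialDeriv (fun x' => E.expectation (M.point x') i) j x =
      expect (fderiv ℝ M.point x (Pi.single j 1)) (T i) := by
    intro i j
    have h1 : (fun x' => E.expectation (M.point x') i) =ᶠ[𝓝 x]
        fun x' => expect (M.point x') (T i) :=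
      (M.eventually_mem_dom hx).mono fun x' hx' => hT i _ (M.point_mem x' hx')
    rw [partialDeriv, h1.fderiv_eq, (fderiv_expect (M.differentiableAt_point hx) (T i)).fderiv]
    rfl
  simp only [IsLocallyUnbiased, h, hT _ _ (M.point_mem x hx)]

theorem trace_vecMulVec_mul (u : Fin n → ℝ) (V : Matrix (Fin n) (Fin n) ℝ) :
    (Matrix.vecMulVec u u * V).trace = u ⬝ᵥ V.mulVec u := by
  rw [Matrix.vecMulVec_mul, Matrix.trace_vecMulVec, dotProduct_comm, Matrix.dotProduct_mulVec]

theorem states_nonempty {x : Fin n → ℝ} (hx : x ∈ M.dom) : (states H).Nonempty :=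
  ⟨_, M.point_mem x hx⟩

theorem dotProduct_mse_mulVec (E : Estimator H n) {x : Fin n → ℝ} (hx : x ∈ M.dom)
    (u : Fin n → ℝ) :
    u ⬝ᵥ (M.mse E x).mulVec u = ∫ y, (u ⬝ᵥ y - u ⬝ᵥ x) ^ 2 ∂(E.outcome (M.point x)) := by
  have hL : ∀ i, MemLp (fun y : Fin n → ℝ => y i - x i) 2 (E.outcome (M.point x)) := fun i =>
    (E.memLp_two _ (M.point_mem x hx) i).sub (memLp_const (x i))
  have hI : ∀ i j, Integrable (fun y : Fin n → ℝ => (y i - x i) * (y j - x j))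
      (E.outcome (M.point x)) := fun i j => (hL i).integrable_mul (hL j)
  have h : ∀ y : Fin n → ℝ, (u ⬝ᵥ y - u ⬝ᵥ x) ^ 2 =
      ∑ i, ∑ j, u i * u j * ((y i - x i) * (y j - x j)) := by
    intro y
    rw [← dotProduct_sub, sq, dotProduct, Finset.sum_mul_sum]
    exact Finset.sum_congr rfl fun i _ => Finset.sum_congr rfl fun j _ => by
      simp only [Pi.sub_apply]
      ring
  simp only [h]
  rw [integral_finsetSum _ fun i _ => integrable_finsetSum _ fun j _ => (hI i j).const_mul _,
    dotProduct]
  refine Finset.sum_congr rfl fun i _ => ?_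
  rw [integral_finsetSum _ fun j _ => (hI i j).const_mul _, Matrix.mulVec, dotProduct,
    Finset.mul_sum]
  refine Finset.sum_congr rfl fun j _ => ?_
  rw [integral_const_mul, mse, Matrix.of_apply]
  ring

/-- The variance of a locally unbiased observable: the Cramér-Rao bound with its defect. -/
theorem symInner_eq_of_unbiased {x : Fin n → ℝ} (hx : x ∈ M.dom) {u : Fin n → ℝ}
    {T : H →L[ℂ] H} (hT : IsSelfAdjoint T)
    (hD : ∀ v, expect (fderiv ℝ M.point x v) T = v ⬝ᵥ u) :
    symInner (M.point x) (T - (u ⬝ᵥ x) • 1) (T - (u ⬝ᵥ x) • 1) =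
      u ⬝ᵥ (M.fisher x)⁻¹.mulVec u +
        symInner (M.point x) (T - M.dualSLD u x) (T - M.dualSLD u x) := by
  have hρ := (M.point_mem x hx).1.isSelfAdjoint
  obtain ⟨w, hw⟩ : ∃ w, w = (M.fisher x)⁻¹.mulVec u := ⟨_, rfl⟩
  have hGw : (M.fisher x).mulVec w = u := by rw [hw, M.fisher_mulVec_inv_mulVec hx]
  have hL := M.isSelfAdjoint_tangentSLD hx w
  have hK : IsSelfAdjoint (T - (u ⬝ᵥ x) • 1) :=
    hT.sub ((IsSelfAdjoint.all _).smul (IsSelfAdjoint.one _))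
  -- Pythagoras: ⟨L_w, K⟩ and ⟨L_w, L_w⟩ have the same value for K = T - ⟨u, x⟩ 1, so K - L_w = T -
  -- A_u(x) is orthogonal to L_w.
  have h1 : symInner (M.point x) (M.tangentSLD x w) (T - (u ⬝ᵥ x) • 1) = w ⬝ᵥ u := by
    rw [symInner_eq hρ hL hK, M.symProd_tangentSLD hx, expect_sub_right, expect_smul_right,
      expect_one_right, M.tr_deriv hx, hD]
    simp
  have h2 : symInner (M.point x) (M.tangentSLD x w) (M.tangentSLD x w) = w ⬝ᵥ u := by
    rw [symInner_eq hρ hL hL, M.symProd_tangentSLD hx, ← M.dotProduct_fisher_mulVec hx, hGw]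
  have h3 := symInner_comm hρ hK hL
  have h4 : T - M.dualSLD u x = (T - (u ⬝ᵥ x) • 1) - M.tangentSLD x w := by
    rw [dualSLD, ← hw, sub_sub]
  rw [h4, ← hw, dotProduct_comm u w]
  generalize T - (u ⬝ᵥ x) • 1 = K at *
  rw [symInner_eq_expect_mul] at h1 h2 h3 ⊢
  rw [symInner_eq_expect_mul] at h3 ⊢
  rw [sub_mul, mul_sub, mul_sub, expect_sub_right, expect_sub_right, expect_sub_right]
  linarith

theorem expect_deriv_sum_smul {E : Estimator H n} {T : Fin n → H →L[ℂ] H}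
    (hT : ∀ i, ∀ ρ ∈ states H, E.expectation ρ i = expect ρ (T i)) {x : Fin n → ℝ}
    (hx : x ∈ M.dom) (h : M.IsLocallyUnbiased E x) (u v : Fin n → ℝ) :
    expect (fderiv ℝ M.point x v) (∑ i, u i • T i) = v ⬝ᵥ u := by
  have h1 := ((M.isLocallyUnbiased_iff hT hx).1 h).2
  conv_lhs => rw [← sum_smul_single v]
  simp only [map_sum, map_smul, expect_sum_left, expect_sum_right, expect_smul_left,
    expect_smul_right, h1]
  simp [dotProduct, mul_comm]

/-- The Cramér-Rao inequality with its defect for a locally unbiased estimator with first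
moments `T`. -/
theorem add_symInner_le {E : Estimator H n} {T : Fin n → H →L[ℂ] H}
    (hTsa : ∀ i, IsSelfAdjoint (T i))
    (hT : ∀ i, ∀ X : H →L[ℂ] H, X.IsPositive → E.expectation X i = expect X (T i))
    {x : Fin n → ℝ} (hx : x ∈ M.dom) (h : M.IsLocallyUnbiased E x) (u : Fin n → ℝ) :
    u ⬝ᵥ (M.fisher x)⁻¹.mulVec u +
        symInner (M.point x) (∑ i, u i • T i - M.dualSLD u x) (∑ i, u i • T i - M.dualSLD u x) ≤
      u ⬝ᵥ (M.mse E x).mulVec u := by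
  have hS := isSelfAdjoint_sum_smul hTsa u
  rw [← M.symInner_eq_of_unbiased hx hS
    (M.expect_deriv_sum_smul (fun i ρ hρ => hT i ρ hρ.1) hx h u), M.dotProduct_mse_mulVec E hx]
  exact E.symInner_le_integral (M.states_nonempty hx) hTsa hT u _ (M.point_mem x hx).1

/-- The SLD Cramér-Rao inequality. -/
theorem dotProduct_inv_fisher_le {E : Estimator H n} {x : Fin n → ℝ} (hx : x ∈ M.dom)
    (h : M.IsLocallyUnbiased E x) (u : Fin n → ℝ) :
    u ⬝ᵥ (M.fisher x)⁻¹.mulVec u ≤ u ⬝ᵥ (M.mse E x).mulVec u := by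
  obtain ⟨T, hTsa, hT⟩ := E.exists_moments (M.states_nonempty hx)
  have h1 := M.add_symInner_le hTsa hT hx h u
  have hS := isSelfAdjoint_sum_smul hTsa u
  have h2 := symInner_self_nonneg (M.point_mem x hx) (hS.sub (M.isSelfAdjoint_dualSLD u hx))
  linarith

/-- A family of estimators whose first moments agree with the observables `dualSLD` at `x₀` and
whose mean squared errors for `⟨u, ξ⟩` approach those of these observables. -/
theorem exists_family_of_mem_dom {x₀ : Fin n → ℝ} (hx₀ : x₀ ∈ M.dom) (u : Fin n → ℝ) :
    ∃ E : ℝ → Estimator H n, ∀ x ∈ M.dom, (∀ v, M.dualSLD v x = M.dualSLD v x₀) →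
      (∀ ε, 0 < ε → M.IsLocallyUnbiased (E ε) x) ∧
      Tendsto (fun ε => u ⬝ᵥ (M.mse (E ε) x).mulVec u) (𝓝[>] 0)
        (𝓝 (u ⬝ᵥ (M.fisher x)⁻¹.mulVec u)) := by
  have hA : ∀ i, IsSelfAdjoint (M.dualSLD (Pi.single i 1 : Fin n → ℝ) x₀) :=
    fun i => M.isSelfAdjoint_dualSLD _ hx₀
  choose F hF using fun ε : {ε : ℝ // 0 < ε} => exists_estimator_of_observables
    (fun i => M.dualSLD (Pi.single i 1 : Fin n → ℝ) x₀) hA u ε.2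
  -- The value for ε ≤ 0 is an irrelevant filler.
  refine ⟨fun ε => if h : 0 < ε then F ⟨ε, h⟩ else F ⟨1, one_pos⟩, fun x hx hconst => ⟨?_, ?_⟩⟩
  · intro ε hε
    simp only [dif_pos hε]
    refine (M.isLocallyUnbiased_iff (fun i ρ hρ => (hF ⟨ε, hε⟩ ρ hρ).1 i) hx).2
      ⟨fun i => ?_, fun i j => ?_⟩
    · rw [← hconst, M.expect_point_dualSLD _ hx]
      simp
    · rw [← hconst, M.expect_deriv_dualSLD _ _ hx]
      simp [Pi.single_apply]
  · have hval : ∀ ε, 0 < ε → u ⬝ᵥ (M.mse (if h : 0 < ε then F ⟨ε, h⟩ else F ⟨1, one_pos⟩) x).mulVec u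
        = (1 + n * ε) * expect (M.point x) (M.dualSLD u x * M.dualSLD u x) - (u ⬝ᵥ x) ^ 2 := by
      intro ε hε
      rw [dif_pos hε, M.dotProduct_mse_mulVec _ hx, (hF ⟨ε, hε⟩ _ (M.point_mem x hx)).2,
        ← M.dualSLD_eq_sum u hx₀, ← hconst, M.expect_point_dualSLD u hx]
      ring
    -- The observable A_u itself has defect 0, so the bound is its variance, which is the error
    -- formula at ε = 0.
    have hlim : u ⬝ᵥ (M.fisher x)⁻¹.mulVec u =
        (1 + n * (0 : ℝ)) * expect (M.point x) (M.dualSLD u x * M.dualSLD u x) -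
          (u ⬝ᵥ x) ^ 2 := by
      have h := M.symInner_eq_of_unbiased hx (M.isSelfAdjoint_dualSLD u hx)
        fun v => M.expect_deriv_dualSLD u v hx
      have h0 : symInner (M.point x) (0 : H →L[ℂ] H) 0 = 0 := by
        rw [symInner_eq_expect_mul, mul_zero, expect_zero_right]
      rw [sub_self, h0, add_zero] at h
      rw [← h, symInner_eq_expect_mul, sub_mul, mul_sub, mul_sub, expect_sub_right,
        expect_sub_right, expect_sub_right, smul_one_mul, smul_one_mul, mul_smul_one,
        expect_smul_right, expect_smul_right, expect_smul_right,
        expect_one_of_mem_states (M.point_mem x hx), M.expect_point_dualSLD u hx]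
      ring
    rw [hlim]
    have hc : Continuous fun ε : ℝ =>
        (1 + n * ε) * expect (M.point x) (M.dualSLD u x * M.dualSLD u x) - (u ⬝ᵥ x) ^ 2 := by
      fun_prop
    refine ((hc.tendsto 0).mono_left nhdsWithin_le_nhds).congr' ?_
    filter_upwards [self_mem_nhdsWithin] with ε hε
    exact (hval ε hε).symm

theorem eventually_isLocallyUnbiased {E : EstimatorFiltration H n} {x : Fin n → ℝ}
    (h : M.IsLocallyUnbiasedFiltration E x) :
    ∀ᶠ ε in 𝓝[>] (0 : ℝ), M.IsLocallyUnbiased (E.est ε) x := by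
  have h1 : ∀ᶠ ε : ℝ in 𝓝 0, (ε : EReal) < E.bound :=
    continuous_coe_real_ereal.continuousAt.eventually_lt continuousAt_const E.bound_pos
  filter_upwards [self_mem_nhdsWithin, nhdsWithin_le_nhds h1] with ε h2 h3
  exact h ε h2 h3

/-- The Cramér-Rao bound is the infimum over the estimators locally unbiased at x: the family built
at x approaches it, without any constancy assumption. A limit that is minimal must therefore equal
the bound. -/
theorem isLocallyEfficientFiltration_vecMulVec_iff (u : Fin n → ℝ) (E : EstimatorFiltration H n)
    {x : Fin n → ℝ} (hx : x ∈ M.dom) :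
    M.IsLocallyEfficientFiltration (Matrix.vecMulVec u u) E x ↔
      M.IsLocallyUnbiasedFiltration E x ∧
        Tendsto (fun ε => u ⬝ᵥ (M.mse (E.est ε) x).mulVec u) (𝓝[>] 0)
          (𝓝 (u ⬝ᵥ (M.fisher x)⁻¹.mulVec u)) := by
  simp only [IsLocallyEfficientFiltration, trace_vecMulVec_mul]
  refine and_congr_right fun hE => ⟨?_, fun h => ⟨_, h, fun E' hE' =>
    M.dotProduct_inv_fisher_le hx hE' u⟩⟩
  rintro ⟨l, hl, hmin⟩
  have h1 : u ⬝ᵥ (M.fisher x)⁻¹.mulVec u ≤ l := by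
    refine ge_of_tendsto hl ?_
    filter_upwards [M.eventually_isLocallyUnbiased hE] with ε hε
    exact M.dotProduct_inv_fisher_le hx hε u
  obtain ⟨F, hF⟩ := M.exists_family_of_mem_dom hx u
  obtain ⟨hF1, hF2⟩ := hF x hx fun _ => rfl
  have h2 : l ≤ u ⬝ᵥ (M.fisher x)⁻¹.mulVec u := by
    refine ge_of_tendsto hF2 ?_
    filter_upwards [self_mem_nhdsWithin] with ε hε
    exact hmin _ (hF1 ε hε)
  rwa [le_antisymm h1 h2]

theorem isEfficientFiltration_vecMulVec_iff (u : Fin n → ℝ) (E : EstimatorFiltration H n) :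
    M.IsEfficientFiltration (Matrix.vecMulVec u u) E ↔
      ∀ x ∈ M.dom, M.IsLocallyUnbiasedFiltration E x ∧
        Tendsto (fun ε => u ⬝ᵥ (M.mse (E.est ε) x).mulVec u) (𝓝[>] 0)
          (𝓝 (u ⬝ᵥ (M.fisher x)⁻¹.mulVec u)) :=
  forall₂_congr fun _ hx => M.isLocallyEfficientFiltration_vecMulVec_iff u E hx

theorem HasConstantDualSLD.exists_isEfficientFiltration {M : Model H n}
    (h : M.HasConstantDualSLD) (u : Fin n → ℝ) :
    ∃ E : EstimatorFiltration H n, M.IsEfficientFiltration (Matrix.vecMulVec u u) E := by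
  rcases M.dom.eq_empty_or_nonempty with hM | ⟨x₀, hx₀⟩
  -- For an empty model the conditions are void, but a filtration still has to consist of some
  -- estimators.
  · obtain ⟨E, -⟩ := exists_estimator_of_observables (H := H) (fun _ : Fin n => 0)
      (fun _ => IsSelfAdjoint.zero _) u one_pos
    exact ⟨⟨⊤, EReal.zero_lt_top, fun _ => E⟩, fun x hx => absurd hx (by simp [hM])⟩
  · obtain ⟨F, hF⟩ := M.exists_family_of_mem_dom hx₀ u
    refine ⟨⟨⊤, EReal.zero_lt_top, F⟩, (M.isEfficientFiltration_vecMulVec_iff u _).2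
      fun x hx => ?_⟩
    obtain ⟨h1, h2⟩ := hF x hx fun v => h v x hx x₀ hx₀
    exact ⟨fun ε hε _ => h1 ε hε, h2⟩

/-- The first moments of an efficient filtration converge to `dualSLD u` at every point. -/
theorem hasConstantDualSLD_of_exists_isEfficientFiltration
    (h : ∀ u : Fin n → ℝ, ∃ E : EstimatorFiltration H n,
      M.IsEfficientFiltration (Matrix.vecMulVec u u) E) : M.HasConstantDualSLD := by
  intro u x hx x' hx'
  obtain ⟨E, hE⟩ := h u
  rw [isEfficientFiltration_vecMulVec_iff] at hE
  -- These moments depend on the estimator alone, not on a point of the model, so their limits found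
  -- at x and at x' must coincide.
  choose T hTsa hT using fun ε : ℝ => (E.est ε).exists_moments (M.states_nonempty hx)
  have hS := fun ε => isSelfAdjoint_sum_smul (hTsa ε) u
  have hlim : ∀ z ∈ M.dom, ∀ v : H,
      Tendsto (fun ε => (∑ i, u i • T ε i) v) (𝓝[>] (0 : ℝ)) (𝓝 (M.dualSLD u z v)) := by
    intro z hz v
    have hsa : ∀ ε, IsSelfAdjoint (∑ i, u i • T ε i - M.dualSLD u z) := fun ε =>
      (hS ε).sub (M.isSelfAdjoint_dualSLD u hz)
    -- The excess of the error over the Cramér-Rao bound tends to 0 and dominates the squared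
    -- distance from the first moment to A_u(z).
    have h1 : Tendsto (fun ε => symInner (M.point z) (∑ i, u i • T ε i - M.dualSLD u z)
        (∑ i, u i • T ε i - M.dualSLD u z)) (𝓝[>] (0 : ℝ)) (𝓝 0) := by
      have h2 := (hE z hz).2.sub_const (u ⬝ᵥ (M.fisher z)⁻¹.mulVec u)
      rw [sub_self] at h2
      refine squeeze_zero' (Eventually.of_forall fun ε =>
        symInner_self_nonneg (M.point_mem z hz) (hsa ε)) ?_ h2
      filter_upwards [M.eventually_isLocallyUnbiased (hE z hz).1] with ε hε
      have := M.add_symInner_le (hTsa ε) (hT ε) hz hε u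
      linarith
    have h3 := (tendsto_apply_of_tendsto_symInner (M.point_mem z hz) hsa h1 v).add_const
      (M.dualSLD u z v)
    simpa only [sub_apply, sub_add_cancel, zero_add] using h3
  ext v
  exact tendsto_nhds_unique (hlim x hx v) (hlim x' hx' v)

end Model

end

end QInfoGeom

theorem mainTheorem1 {H : Type*} [NormedAddCommGroup H] [InnerProductSpace ℂ H]
    [FiniteDimensional ℂ H] [CompleteSpace H] {n : ℕ} (M : QInfoGeom.Model H n) :
    ((M.IsEAutoparallel ∧ M.IsMAffine) ↔
      ∀ u : Fin n → ℝ, ∃ E : QInfoGeom.EstimatorFiltration H n,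
        M.IsEfficientFiltration (Matrix.vecMulVec u u) E) ∧
    ∀ (u : Fin n → ℝ) (E : QInfoGeom.EstimatorFiltration H n),
      M.IsEfficientFiltration (Matrix.vecMulVec u u) E ↔
        ∀ x ∈ M.dom, M.IsLocallyUnbiasedFiltration E x ∧
          Tendsto (fun ε => u ⬝ᵥ (M.mse (E.est ε) x).mulVec u) (𝓝[>] 0)
            (𝓝 (u ⬝ᵥ (M.fisher x)⁻¹.mulVec u)) :=
  ⟨M.isEAutoparallel_and_isMAffine_iff.trans
    ⟨fun h u => h.exists_isEfficientFiltration u,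
      M.hasConstantDualSLD_of_exists_isEfficientFiltration⟩,
    M.isEfficientFiltration_vecMulVec_iff⟩
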